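/- Identify $\mathbb{R}^3$ with the imaginary quaternions. For quaternions put $\mathrm{cr}(a,b,c,d) = (a-b)(b-c)^{-1}(c-d)(d-a)^{-1}$, and for $q = |q|[\cos\varphi, v\sin\varphi]$ with $\|v\| = 1$, $\varphi\in[0,\pi]$, let $\sqrt q = \sqrt{|q|}\,[\cos\frac{\varphi}{2}, v\sin\frac{\varphi}{2}]$ ($q$ not a negative real). For pairwise distinct $a,b,c,d\in\mathbb{R}^3$ such that $\mathrm{cr}(c,a,b,d)$ is not a negative real let $$f(a,b,c,d) = \big((b-a)(c-a)^{-1}\sqrt{\mathrm{cr}(c,a,b,d)}+1\big)^{-1}\big((b-a)(c-a)^{-1}\sqrt{\mathrm{cr}(c,a,b,d)}\,c+b\big),$$ whenever the inverted factor is nonzero. For a discrete curve $\gamma:\mathbb{Z}\to\mathbb{R}^3$ and $i\in\mathbb{Z}$ put $(a,b,c,d) = (\gamma_{i-1},\gamma_i,\gamma_{i+1},\gamma_{i+2})$ and $$p_{ab}=f(d,a,b,c),\quad p_{bc}=f(a,b,c,d),\quad p_{cd}=f(b,c,d,a),\quad p_{da}=f(c,d,a,b).$$ The discrete curvature circle $k_i$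 is the circle in $\mathbb{R}^3$ through $p_{ab},p_{bc},p_{cd},p_{da}$; let $m_i$ and $r_i>0$ be its center and radius. The discrete Frenet frame $(T_i,N_i,B_i)$ at the edge $\gamma_i\gamma_{i+1}$ consists of the unit tangent vector $T_i$ of $k_i$ at $p_{bc}$, oriented so that $\langle T_i,\gamma_{i+1}-\gamma_i\rangle>0$, the unit normal $N_i = (m_i-p_{bc})/r_i$ of $k_i$ at $p_{bc}$, and $B_i = T_i\times N_i$. Let $s:\mathbb{R}\to\mathbb{R}^3$ be a $C^4$ curve, and let $u\in\mathbb{R}$ be such that $s'(u)\times s''(u)\neq 0$. Near $u$ the smooth Frenet frame of $s$ is $T = s'/\|s'\|$, $B = (s'\times s'')/\|s'\times s''\|$, $N = B\times T$. For $\varepsilon\ne0$ let $\gamma_k = s(u+(2k-1)\varepsilon)$, $k\in\mathbb{Z}$. Then, for every fixed $i\in\mathbb{Z}$ and for all sufficiently small $\varepsilon\neq 0$, the four points $p_{ab},p_{bc},p_{cd},p_{da}$ are well-defined points of $\mathbb{R}^3$ which span a plane and lie on a circle of that plane, the discrete Frenet frame $(T_i,N_i,B_i)$ of $\gamma$ at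 the edge $\gamma_i\gamma_{i+1}$ exists and is unique, and, as $\varepsilon\to0$, $$\operatorname{sign}(\varepsilon)\,T_i = T(u+2i\varepsilon)+O(\varepsilon^2),\qquad N_i = N(u+2i\varepsilon)+O(\varepsilon^2),\qquad \operatorname{sign}(\varepsilon)\,B_i = B(u+2i\varepsilon)+O(\varepsilon^2).$$ In particular, for $\varepsilon\to0^+$ and $i=0$, the frame $(T_0,N_0,B_0)$ is a second-order approximation of $(T(u),N(u),B(u))$. -/

import Mathlib

open Filter Topology Asymptotics
open scoped Quaternion

noncomputable section

/-- Euclidean three-space. -/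
abbrev E3 : Type := EuclideanSpace ℝ (Fin 3)

/-- The cross product of `ℝ³`, on Euclidean space. -/
def cross (v w : E3) : E3 := WithLp.toLp 2 (crossProduct v.ofLp w.ofLp)

/-- A triple of vectors of `ℝ³`: tangent, normal and binormal. -/
@[ext]
structure Frame3 where
  T : E3
  N : E3
  B : E3

/-! ### The smooth Frenet frame -/

/-- Unit tangent `s' / ‖s'‖`. -/
def smoothT (s : ℝ → E3) (u : ℝ) : E3 := ‖deriv s u‖⁻¹ • deriv s u

/-- Unit binormal `(s' × s'') / ‖s' × s''‖`. -/
def smoothB (s : ℝ → E3) (u : ℝ) : E3 :=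
  ‖cross (deriv s u) (deriv (deriv s) u)‖⁻¹ • cross (deriv s u) (deriv (deriv s) u)

/-- Unit normal `B × T`. -/
def smoothN (s : ℝ → E3) (u : ℝ) : E3 := cross (smoothB s u) (smoothT s u)

/-! ### Quaternions, cross-ratio and the point-insertion rule -/

/-- The identification of `ℝ³` with the imaginary quaternions, `v ↦ [0, v]`. -/
def toQuat (v : E3) : ℍ[ℝ] := ⟨0, v 0, v 1, v 2⟩

/-- The quaternionic cross-ratio `(a - b) (b - c)⁻¹ (c - d) (d - a)⁻¹`. -/
def crossRatio (a b c d : ℍ[ℝ]) : ℍ[ℝ] := (a - b) * (b - c)⁻¹ * (c - d) * (d - a)⁻¹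

/-- The polar angle `φ ∈ [0, π]` of `q = |q| [cos φ, v sin φ]` with `‖v‖ = 1`. -/
def quatAngle (q : ℍ[ℝ]) : ℝ := Real.arccos (q.re / ‖q‖)

/-- The principal square root `√|q| [cos (φ/2), v sin (φ/2)]` of `q = |q| [cos φ, v sin φ]`,
where `v = Im q / |Im q|`. It is only used away from the negative real axis, where `v` is not
determined; on the nonnegative reals the imaginary part is zero. -/
def quatSqrt (q : ℍ[ℝ]) : ℍ[ℝ] :=
  Real.sqrt ‖q‖ •
    ((Real.cos (quatAngle q / 2) : ℍ[ℝ]) + Real.sin (quatAngle q / 2) • (‖q.im‖⁻¹ • q.im))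

/-- The factor `(b - a) (c - a)⁻¹ √cr(c, a, b, d)` of the point-insertion rule. -/
def insertFactor (a b c d : ℍ[ℝ]) : ℍ[ℝ] :=
  (b - a) * (c - a)⁻¹ * quatSqrt (crossRatio c a b d)

/-- The point-insertion rule
`f(a, b, c, d) = ((b - a) (c - a)⁻¹ √cr + 1)⁻¹ ((b - a) (c - a)⁻¹ √cr c + b)`,
with `cr = cr(c, a, b, d)`. -/
def insertPoint (a b c d : ℍ[ℝ]) : ℍ[ℝ] :=
  (insertFactor a b c d + 1)⁻¹ * (insertFactor a b c d * c + b)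

/-- `p` is the (finite) point `f(a, b, c, d)` of `ℝ³` inserted to four pairwise distinct points
whose cross-ratio `cr(c, a, b, d)` is not a negative real. -/
structure IsInsertedPoint (a b c d p : E3) : Prop where
  distinct : a ≠ b ∧ a ≠ c ∧ a ≠ d ∧ b ≠ c ∧ b ≠ d ∧ c ≠ d
  not_neg : ¬ ((crossRatio (toQuat c) (toQuat a) (toQuat b) (toQuat d)).im = 0 ∧
    (crossRatio (toQuat c) (toQuat a) (toQuat b) (toQuat d)).re < 0)
  finite : insertFactor (toQuat a) (toQuat b) (toQuat c) (toQuat d) + 1 ≠ 0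
  eq : toQuat p = insertPoint (toQuat a) (toQuat b) (toQuat c) (toQuat d)

/-! ### The discrete curvature circle and the discrete Frenet frame -/

/-- The points of `S` span a plane and lie on the circle of that plane with center `m` and
radius `r > 0`. -/
structure IsCircleThrough (S : Set E3) (m : E3) (r : ℝ) : Prop where
  pos : 0 < r
  dist_eq : ∀ p ∈ S, dist p m = r
  center_mem : m ∈ affineSpan ℝ S
  planar : Module.finrank ℝ (vectorSpan ℝ S) = 2

/-- `F` is the discrete Frenet frame of the discrete curve `γ` at the edge `γ i, γ (i + 1)`.
With `a, b, c, d = γ (i - 1), γ i, γ (i + 1), γ (i + 2)`, the curvature circle is the circle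
through `pab, pbc, pcd, pda`; `F.T` is its unit tangent vector at `pbc`, oriented in the direction
of the edge; `F.N` is its unit normal at `pbc`, pointing to the center; `F.B = F.T × F.N`. -/
def IsDiscreteFrenetFrame (γ : ℤ → E3) (i : ℤ) (F : Frame3) : Prop :=
  ∃ pab pbc pcd pda m : E3, ∃ r : ℝ,
    IsInsertedPoint (γ (i + 2)) (γ (i - 1)) (γ i) (γ (i + 1)) pab ∧
    IsInsertedPoint (γ (i - 1)) (γ i) (γ (i + 1)) (γ (i + 2)) pbc ∧
    IsInsertedPoint (γ i) (γ (i + 1)) (γ (i + 2)) (γ (i - 1)) pcd ∧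
    IsInsertedPoint (γ (i + 1)) (γ (i + 2)) (γ (i - 1)) (γ i) pda ∧
    IsCircleThrough {pab, pbc, pcd, pda} m r ∧
    ‖F.T‖ = 1 ∧ F.T ∈ vectorSpan ℝ {pab, pbc, pcd, pda} ∧
    inner ℝ F.T (pbc - m) = 0 ∧ 0 < inner ℝ F.T (γ (i + 1) - γ i) ∧
    F.N = r⁻¹ • (m - pbc) ∧
    F.B = cross F.T F.N

/-- The discrete curve `γ_k = s (u + (2 k - 1) ε)` sampled from `s`. -/
def sample (s : ℝ → E3) (u ε : ℝ) (k : ℤ) : E3 := s (u + (2 * (k : ℝ) - 1) * ε)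

end

/-!
The inserted points are Möbius covariant, and the proof works in the picture inverted at the
inserted point `p = p_bc` of the edge. By the insertion rule `-cr(c, a, b, p)` is the square
root of `cr(c, a, b, d)`, and hence the inversion `z ↦ (z - p)⁻¹` maps `a, b, d, c` to the
vertices of a parallelogram (`parallelogram_of_insertFactor`). With its center `o`, the points
`b, c` become `o ± v` and the points `a, d` become `o ± w`. The three other inserted points then
have the images `o + g`, `o - g`, `o`, where `g = √(w v⁻¹) v`
(`isInsertedPoint_of_parallelogram`). These lie on a line, and the curvature circle is the
inverse of this line. Hence its tangent at `p` has the direction of `g`, and its normal at `p`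
points against the component of `o` orthogonal to `g` (`isDiscreteFrenetFrame_iff`,
`isDiscreteFrenetFrame_iff_of_inverted`). In particular the discrete frame exists and is unique
as soon as this component is not zero.

For the sampled curve write `b, c = m ∓ ε x + ε² y` and `a, d = m ∓ ε x₃ + ε² y₃`, where `m` is
the value of `s` at the mid-parameter of the edge. By Taylor's theorem `x = s' + O(ε²)`,
`y = s''/2 + O(ε²)`, `x₃ = 3 x + O(ε²)`, `y₃ = 9 y + O(ε²)` (`edgeExpansion_curve`). A direct
estimate of the insertion rule gives `p = m + ε² (y - r)` with `r` bounded. Now `o` is the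
midpoint of the images of `b, c`, and also that of the images of `a, d`, so that
`o = - x⁻¹ r x⁻¹ + O(ε²) = - x₃⁻¹ (r + y₃ - y) x₃⁻¹ + O(ε²)`; the terms of first order cancel by
symmetry. Comparing both expressions yields `r = y + O(ε²)`, whence `o = - x⁻¹ y x⁻¹ + O(ε²)`,
while `ε v = - x⁻¹ + O(ε²)` and `ε w = - x⁻¹ / 3 + O(ε²)` (`EdgeExpansion.inverted_isBigO`), so
that `ε g = - x⁻¹ / √3 + O(ε²)` (`EdgeExpansion.geometricMean_isBigO`). Since
`- x⁻¹ = x / |x|²`, and since the component of `x⁻¹ y x⁻¹` orthogonal to `x` is a positive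
multiple of `(s' × s'') × s'` up to `O(ε²)`, smooth dependence of the frame on `ε g` and `o`
gives the claim (`frame_isBigO`).
-/

/-! ### The principal square root of a quaternion -/

theorem norm_sq_eq_components (q : ℍ[ℝ]) :
    ‖q‖ ^ 2 = q.re ^ 2 + q.imI ^ 2 + q.imJ ^ 2 + q.imK ^ 2 := by
  rw [← Quaternion.normSq_def', Quaternion.normSq_eq_norm_mul_self, sq]

theorem mul_self_eq_smul_sub (q : ℍ[ℝ]) : q * q = (2 * q.re) • q - (‖q‖ ^ 2) • (1 : ℍ[ℝ]) := by
  rw [norm_sq_eq_components]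
  ext <;> simp [Quaternion.re_mul, Quaternion.imI_mul, Quaternion.imJ_mul, Quaternion.imK_mul] <;>
    ring

/-- A square root with positive real part is unique. -/
theorem eq_of_mul_self_eq_of_re_pos {S R : ℍ[ℝ]} (hS : 0 < S.re) (hR : 0 < R.re)
    (h : S * S = R * R) : S = R := by
  have hn : ‖S‖ = ‖R‖ := by
    have := congrArg norm h
    rw [norm_mul, norm_mul] at this
    nlinarith [norm_nonneg S, norm_nonneg R]
  have h1 : S.re • S = R.re • R := by
    rw [mul_self_eq_smul_sub, mul_self_eq_smul_sub, hn] at h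
    have h2 : (2 : ℝ) • (S.re • S) = (2 : ℝ) • (R.re • R) := by
      simpa [smul_smul] using h
    exact smul_right_injective _ (two_ne_zero (α := ℝ)) h2
  have h2 : S.re = R.re := by
    have := congrArg (fun q : ℍ[ℝ] => q.re) h1
    simp only [Quaternion.re_smul, smul_eq_mul] at this
    nlinarith
  rw [h2] at h1
  exact smul_right_injective _ hR.ne' h1

theorem norm_sq_eq_re_sq_add (q : ℍ[ℝ]) : ‖q‖ ^ 2 = q.re ^ 2 + ‖q.im‖ ^ 2 := by
  rw [norm_sq_eq_components, norm_sq_eq_components]; simp; ring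

theorem abs_re_le_norm (q : ℍ[ℝ]) : |q.re| ≤ ‖q‖ :=
  abs_le_of_sq_le_sq (by rw [norm_sq_eq_re_sq_add]; nlinarith [sq_nonneg ‖q.im‖]) (norm_nonneg q)

theorem cos_quatAngle {q : ℍ[ℝ]} (hq : q ≠ 0) : Real.cos (quatAngle q) = q.re / ‖q‖ := by
  have h := abs_le.1 (abs_re_le_norm q)
  have h0 := norm_pos_iff.2 hq
  exact Real.cos_arccos (by rw [le_div_iff₀ h0]; linarith) (by rw [div_le_iff₀ h0]; linarith)

theorem sin_quatAngle {q : ℍ[ℝ]} (hq : q ≠ 0) : Real.sin (quatAngle q) = ‖q.im‖ / ‖q‖ := by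
  have h0 := norm_pos_iff.2 hq
  rw [quatAngle, Real.sin_arccos, div_pow, norm_sq_eq_re_sq_add q]
  have h1 : 0 < q.re ^ 2 + ‖q.im‖ ^ 2 := by rw [← norm_sq_eq_re_sq_add]; positivity
  rw [← norm_sq_eq_re_sq_add, show 1 - q.re ^ 2 / ‖q‖ ^ 2 = (‖q.im‖ / ‖q‖) ^ 2 by
    field_simp; rw [norm_sq_eq_re_sq_add q]; ring]
  exact Real.sqrt_sq (by positivity)

theorem quatSqrt_eq (q : ℍ[ℝ]) :
    quatSqrt q = (Real.sqrt ‖q‖ * Real.cos (quatAngle q / 2)) • (1 : ℍ[ℝ])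
      + (Real.sqrt ‖q‖ * Real.sin (quatAngle q / 2) * ‖q.im‖⁻¹) • q.im := by
  unfold quatSqrt
  generalize Real.cos (quatAngle q / 2) = C, Real.sin (quatAngle q / 2) = D, ‖q.im‖⁻¹ = n
  ext <;> simp <;> ring

theorem quatSqrt_re (q : ℍ[ℝ]) :
    (quatSqrt q).re = Real.sqrt ‖q‖ * Real.cos (quatAngle q / 2) := by
  simp [quatSqrt_eq]

theorem quatSqrt_re_nonneg (q : ℍ[ℝ]) : 0 ≤ (quatSqrt q).re := by
  rw [quatSqrt_re]
  refine mul_nonneg (Real.sqrt_nonneg _) (Real.cos_nonneg_of_mem_Icc ⟨?_, ?_⟩)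
  · have := Real.arccos_nonneg (q.re / ‖q‖); unfold quatAngle; linarith [Real.pi_pos]
  · have := Real.arccos_le_pi (q.re / ‖q‖); unfold quatAngle; linarith [Real.pi_pos]

theorem quatSqrt_mul_self {q : ℍ[ℝ]} (hn : ¬ (q.im = 0 ∧ q.re < 0)) :
    quatSqrt q * quatSqrt q = q := by
  rcases eq_or_ne q 0 with rfl | hq
  · simp [quatSqrt]
  have h0 := norm_pos_iff.2 hq
  have hc : Real.cos (quatAngle q) = q.re / ‖q‖ := cos_quatAngle hq
  have hs : Real.sin (quatAngle q) = ‖q.im‖ / ‖q‖ := sin_quatAngle hq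
  have hc2 : Real.cos (quatAngle q / 2) ^ 2 - Real.sin (quatAngle q / 2) ^ 2 = q.re / ‖q‖ := by
    rw [← hc, ← Real.cos_two_mul']; congr 1; ring
  have hs2 : 2 * Real.sin (quatAngle q / 2) * Real.cos (quatAngle q / 2) = ‖q.im‖ / ‖q‖ := by
    rw [← hs, ← Real.sin_two_mul]; congr 1; ring
  have hsq : Real.sqrt ‖q‖ ^ 2 = ‖q‖ := Real.sq_sqrt h0.le
  by_cases him : q.im = 0
  · have hre : 0 ≤ q.re := by by_contra h; exact hn ⟨him, not_le.1 h⟩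
    have hnr : ‖q‖ = q.re := by
      have := norm_sq_eq_re_sq_add q
      rw [him, norm_zero] at this
      nlinarith
    have hφ0 : quatAngle q = 0 := by
      rw [quatAngle, hnr, div_self (hnr ▸ h0.ne'), Real.arccos_one]
    have hq' : q = q.re • (1 : ℍ[ℝ]) := by
      conv_lhs => rw [← Quaternion.re_add_im q, him, add_zero]
      ext <;> simp
    have : quatSqrt q = Real.sqrt ‖q‖ • (1 : ℍ[ℝ]) := by
      rw [quatSqrt_eq, him, hφ0]; simp
    rw [this, Algebra.mul_smul_comm, Algebra.smul_mul_assoc, smul_smul, mul_one, ← sq, hsq, hnr]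
    exact hq'.symm
  · have hI : 0 < ‖q.im‖ := norm_pos_iff.2 him
    have hI2 : ‖q.im‖ ^ 2 = q.imI ^ 2 + q.imJ ^ 2 + q.imK ^ 2 := by
      rw [norm_sq_eq_components]; simp
    rw [quatSqrt_eq]
    generalize Real.cos (quatAngle q / 2) = C at *
    generalize Real.sin (quatAngle q / 2) = D at *
    generalize Real.sqrt ‖q‖ = r at *
    have hre : q.re = r ^ 2 * (C ^ 2 - D ^ 2) := by rw [hsq, hc2]; field_simp
    have hcoef : 2 * (r * C) * (r * D * ‖q.im‖⁻¹) = 1 := by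
      rw [show 2 * (r * C) * (r * D * ‖q.im‖⁻¹) = r ^ 2 * (2 * D * C) * ‖q.im‖⁻¹ by ring, hsq, hs2]
      field_simp
    have hD : (r * D * ‖q.im‖⁻¹) ^ 2 * (q.imI ^ 2 + q.imJ ^ 2 + q.imK ^ 2) = r ^ 2 * D ^ 2 := by
      rw [← hI2]; field_simp
    generalize r * D * ‖q.im‖⁻¹ = t at *
    ext
    · simp [Quaternion.re_mul]; rw [hre]; linear_combination -hD
    · simp [Quaternion.imI_mul]; linear_combination q.imI * hcoef
    · simp [Quaternion.imJ_mul]; linear_combination q.imJ * hcoef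
    · simp [Quaternion.imK_mul]; linear_combination q.imK * hcoef

theorem quatSqrt_re_pos {q : ℍ[ℝ]} (hq : q ≠ 0) (hn : ¬ (q.im = 0 ∧ q.re < 0)) :
    0 < (quatSqrt q).re := by
  refine lt_of_le_of_ne (quatSqrt_re_nonneg q) fun h => ?_
  have h1 := mul_self_eq_smul_sub (quatSqrt q)
  rw [quatSqrt_mul_self hn, ← h] at h1
  simp only [mul_zero, zero_smul, zero_sub] at h1
  have h2 : 0 < ‖quatSqrt q‖ := by
    rw [norm_pos_iff]
    intro h0
    have := quatSqrt_mul_self hn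
    rw [h0, mul_zero] at this
    exact hq this.symm
  apply hn
  rw [h1]
  constructor
  · ext <;> simp
  · simp only [Quaternion.re_neg, Quaternion.re_smul, Quaternion.re_one, smul_eq_mul]; nlinarith

/-- The square of a quaternion with positive real part avoids the negative real axis. -/
theorem mul_self_not_neg {S : ℍ[ℝ]} (hS : 0 < S.re) : ¬ ((S * S).im = 0 ∧ (S * S).re < 0) := by
  rintro ⟨h1, h2⟩
  have e1 := congrArg (fun q : ℍ[ℝ] => q.imI) h1
  have e2 := congrArg (fun q : ℍ[ℝ] => q.imJ) h1
  have e3 := congrArg (fun q : ℍ[ℝ] => q.imK) h1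
  simp [Quaternion.imI_mul, Quaternion.imJ_mul, Quaternion.imK_mul, Quaternion.re_mul]
    at e1 e2 e3 h2
  have f1 : S.imI = 0 := by
    have : S.re * S.imI = 0 := by linarith
    exact (mul_eq_zero.1 this).resolve_left hS.ne'
  have f2 : S.imJ = 0 := by
    have : S.re * S.imJ = 0 := by linarith
    exact (mul_eq_zero.1 this).resolve_left hS.ne'
  have f3 : S.imK = 0 := by
    have : S.re * S.imK = 0 := by linarith
    exact (mul_eq_zero.1 this).resolve_left hS.ne'
  rw [f1, f2, f3] at h2
  nlinarith

theorem quatSqrt_of_mul_self {S : ℍ[ℝ]} (hS : 0 < S.re) : quatSqrt (S * S) = S := by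
  have hS0 : S ≠ 0 := by rintro rfl; simp at hS
  exact eq_of_mul_self_eq_of_re_pos (quatSqrt_re_pos (mul_ne_zero hS0 hS0) (mul_self_not_neg hS)) hS
    (quatSqrt_mul_self (mul_self_not_neg hS))

theorem quatSqrt_mem_span (q : ℍ[ℝ]) : ∃ α β : ℝ, quatSqrt q = β • (1 : ℍ[ℝ]) + α • q := by
  refine ⟨Real.sqrt ‖q‖ * Real.sin (quatAngle q / 2) * ‖q.im‖⁻¹,
    Real.sqrt ‖q‖ * Real.cos (quatAngle q / 2)
      - Real.sqrt ‖q‖ * Real.sin (quatAngle q / 2) * ‖q.im‖⁻¹ * q.re, ?_⟩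
  rw [quatSqrt_eq]
  ext <;> simp

/-! ### Inserted points -/

theorem toQuat_injective : Function.Injective toQuat := by
  intro v w h
  have h1 := congrArg (fun q : ℍ[ℝ] => q.imI) h
  have h2 := congrArg (fun q : ℍ[ℝ] => q.imJ) h
  have h3 := congrArg (fun q : ℍ[ℝ] => q.imK) h
  simp only [toQuat] at h1 h2 h3
  ext i; fin_cases i <;> assumption

@[simp]
theorem toQuat_re (v : E3) : (toQuat v).re = 0 := rfl

@[simp]
theorem toQuat_imI (v : E3) : (toQuat v).imI = v 0 := rfl

@[simp]
theorem toQuat_imJ (v : E3) : (toQuat v).imJ = v 1 := rfl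

@[simp]
theorem toQuat_imK (v : E3) : (toQuat v).imK = v 2 := rfl

theorem toQuat_add (v w : E3) : toQuat (v + w) = toQuat v + toQuat w := by ext <;> simp

theorem toQuat_smul (t : ℝ) (v : E3) : toQuat (t • v) = t • toQuat v := by ext <;> simp

theorem toQuat_neg (v : E3) : toQuat (-v) = -toQuat v := by ext <;> simp

theorem toQuat_sub (v w : E3) : toQuat (v - w) = toQuat v - toQuat w := by ext <;> simp

theorem inv_re_eq_zero {u : ℍ[ℝ]} (hu : u.re = 0) : (u⁻¹).re = 0 := by
  rw [← Quaternion.star_eq_neg] at hu ⊢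
  rw [star_inv₀, hu, inv_neg]

/-- For imaginary `u, z` the product `u z⁻¹ u` is imaginary, since conjugation negates it. -/
theorem mul_inv_mul_re_eq_zero {u z : ℍ[ℝ]} (hu : u.re = 0) (hz : z.re = 0) :
    (u * z⁻¹ * u).re = 0 := by
  have hz := inv_re_eq_zero hz
  rw [← Quaternion.star_eq_neg] at hu hz ⊢
  simp [star_mul, hu, hz, mul_assoc]

theorem re_mul_inv_mul_sub {u z : ℍ[ℝ]} (hu : u.re = 0) (hz : z.re = 0) (h0 : z ≠ 0) :
    (u * z⁻¹ * (z - u)).re = 0 := by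
  have : u * z⁻¹ * (z - u) = u - u * z⁻¹ * u := by
    rw [mul_sub, mul_assoc u, inv_mul_cancel₀ h0, mul_one]
  rw [this, Quaternion.re_sub, hu, mul_inv_mul_re_eq_zero hu hz, sub_zero]

theorem mul_inv_mul_crossRatio {a b c d : ℍ[ℝ]} (hab : a ≠ b) (hac : a ≠ c) :
    (b - a) * (c - a)⁻¹ * crossRatio c a b d = (b - d) * (c - d)⁻¹ := by
  have h1 : c - a ≠ 0 := sub_ne_zero.2 hac.symm
  have h2 : a - b ≠ 0 := sub_ne_zero.2 hab
  rw [crossRatio, ← neg_sub a b, ← neg_sub d c, inv_neg]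
  simp only [mul_assoc, inv_mul_cancel_left₀ h1, neg_mul, mul_neg, mul_inv_cancel_left₀ h2]

/-- The insertion rule maps imaginary quaternions to an imaginary quaternion: the insertion factor
is a real combination of `(b - a) (c - a)⁻¹` and `(b - d) (c - d)⁻¹`, and the imaginary parts of
both are orthogonal to `c - b`. -/
theorem insertPoint_re {a b c d : ℍ[ℝ]} (ha : a.re = 0) (hb : b.re = 0) (hc : c.re = 0)
    (hd : d.re = 0) (hab : a ≠ b) (hac : a ≠ c) (hcd : c ≠ d) : (insertPoint a b c d).re = 0 := by
  have hX : (insertFactor a b c d * (c - b)).re = 0 := by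
    obtain ⟨α, β, h⟩ := quatSqrt_mem_span (crossRatio c a b d)
    have h1 := re_mul_inv_mul_sub (u := b - a) (z := c - a) (by simp [ha, hb]) (by simp [ha, hc])
      (sub_ne_zero.2 hac.symm)
    have h2 := re_mul_inv_mul_sub (u := b - d) (z := c - d) (by simp [hd, hb]) (by simp [hd, hc])
      (sub_ne_zero.2 hcd)
    rw [sub_sub_sub_cancel_right] at h1 h2
    rw [insertFactor, h, mul_add, mul_smul_comm, mul_one, mul_smul_comm,
      mul_inv_mul_crossRatio hab hac, add_mul, smul_mul_assoc, smul_mul_assoc]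
    simp [h1, h2]
  rw [insertPoint]
  generalize insertFactor a b c d = X at *
  have key : (star (X + 1) * (X * c + b)).re = 0 := by
    simp [Quaternion.re_mul, Quaternion.imI_mul, Quaternion.imJ_mul, Quaternion.imK_mul,
      hc, hb] at hX ⊢
    linear_combination hX
  rw [Quaternion.instInv]
  simp only []
  rw [smul_mul_assoc, Quaternion.re_smul, key, smul_zero]

theorem insertPoint_eq_iff {a b c d p : ℍ[ℝ]} (h : insertFactor a b c d + 1 ≠ 0) :
    p = insertPoint a b c d ↔ insertFactor a b c d * (p - c) = b - p := by
  rw [insertPoint, eq_inv_mul_iff_mul_eq₀ h, add_mul, mul_sub, one_mul]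
  constructor <;> intro h
  · rw [sub_eq_sub_iff_add_eq_add, h, add_comm]
  · rw [sub_eq_sub_iff_add_eq_add] at h; rw [h, add_comm]

/-- Inversion conjugates the cross-ratio. -/
theorem crossRatio_inv {a b c d : ℍ[ℝ]} (ha : a ≠ 0) (hb : b ≠ 0) (hc : c ≠ 0) (hd : d ≠ 0) :
    crossRatio a⁻¹ b⁻¹ c⁻¹ d⁻¹ = a⁻¹ * crossRatio a b c d * a := by
  have e1 : a⁻¹ - b⁻¹ = -(a⁻¹ * (a - b) * b⁻¹) := by rw [inv_sub_inv' ha hb]; noncomm_ring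
  have e2 : (b⁻¹ - c⁻¹)⁻¹ = -(b * (b - c)⁻¹ * c) := by
    have : b⁻¹ - c⁻¹ = -(c⁻¹ * (b - c) * b⁻¹) := by
      rw [← neg_sub, inv_sub_inv' hc hb]
    rw [this, inv_neg, mul_inv_rev, mul_inv_rev, inv_inv, inv_inv, mul_assoc]
  have e3 : c⁻¹ - d⁻¹ = -(c⁻¹ * (c - d) * d⁻¹) := by rw [inv_sub_inv' hc hd]; noncomm_ring
  have e4 : (d⁻¹ - a⁻¹)⁻¹ = -(d * (d - a)⁻¹ * a) := by
    have : d⁻¹ - a⁻¹ = -(a⁻¹ * (d - a) * d⁻¹) := by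
      rw [← neg_sub, inv_sub_inv' ha hd]
    rw [this, inv_neg, mul_inv_rev, mul_inv_rev, inv_inv, inv_inv, mul_assoc]
  rw [crossRatio, e1, e2, e3, e4, crossRatio]
  simp only [neg_mul, mul_neg, neg_neg, mul_assoc, inv_mul_cancel_left₀ hb,
    mul_inv_cancel_left₀ hc, inv_mul_cancel_left₀ hd]

theorem crossRatio_add_left (p a b c d : ℍ[ℝ]) :
    crossRatio (p + a) (p + b) (p + c) (p + d) = crossRatio a b c d := by
  simp [crossRatio]

theorem re_conj_mul {a : ℍ[ℝ]} (ha : a ≠ 0) (q : ℍ[ℝ]) : (a⁻¹ * q * a).re = q.re := by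
  have h (x y : ℍ[ℝ]) : (x * y).re = (y * x).re := by simp [Quaternion.re_mul]; ring
  rw [mul_assoc, h, mul_assoc, mul_inv_cancel₀ ha, mul_one]

/-- The inserted point `f(a, b, c, d)` is characterized by cross-ratios: `- cr(c, a, b, p)` is the
principal square root of `cr(c, a, b, d)`. -/
theorem IsInsertedPoint.of_crossRatio {a b c d p : E3}
    (hd : a ≠ b ∧ a ≠ c ∧ a ≠ d ∧ b ≠ c ∧ b ≠ d ∧ c ≠ d)
    (hsq : crossRatio (toQuat c) (toQuat a) (toQuat b) (toQuat p)
      * crossRatio (toQuat c) (toQuat a) (toQuat b) (toQuat p)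
        = crossRatio (toQuat c) (toQuat a) (toQuat b) (toQuat d))
    (hre : (crossRatio (toQuat c) (toQuat a) (toQuat b) (toQuat p)).re < 0) :
    IsInsertedPoint a b c d p := by
  obtain ⟨S, hS⟩ : ∃ S, S = -crossRatio (toQuat c) (toQuat a) (toQuat b) (toQuat p) := ⟨_, rfl⟩
  have hSre : 0 < S.re := by rw [hS, Quaternion.re_neg]; linarith
  have hSS : S * S = crossRatio (toQuat c) (toQuat a) (toQuat b) (toQuat d) := by
    rw [hS, neg_mul_neg, hsq]
  have hpc : p ≠ c := by rintro rfl; simp [crossRatio] at hre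
  have hab := toQuat_injective.ne hd.1
  have hac := toQuat_injective.ne hd.2.1
  have hbc := toQuat_injective.ne hd.2.2.2.1
  have hpc' := sub_ne_zero.2 (toQuat_injective.ne hpc)
  have hX : insertFactor (toQuat a) (toQuat b) (toQuat c) (toQuat d)
      = (toQuat b - toQuat p) * (toQuat p - toQuat c)⁻¹ := by
    rw [insertFactor, ← hSS, quatSqrt_of_mul_self hSre, hS, mul_neg,
      mul_inv_mul_crossRatio hab hac, ← neg_sub (toQuat p) (toQuat c), inv_neg, mul_neg, neg_neg]
  have h1 : insertFactor (toQuat a) (toQuat b) (toQuat c) (toQuat d) + 1 ≠ 0 := by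
    have : insertFactor (toQuat a) (toQuat b) (toQuat c) (toQuat d) + 1
        = (toQuat b - toQuat c) * (toQuat p - toQuat c)⁻¹ := by
      rw [hX, ← sub_add_sub_cancel (toQuat b) (toQuat p) (toQuat c), add_mul, mul_inv_cancel₀ hpc']
    rw [this]
    exact mul_ne_zero (sub_ne_zero.2 hbc) (inv_ne_zero hpc')
  refine ⟨hd, hSS ▸ mul_self_not_neg hSre, h1, (insertPoint_eq_iff h1).2 ?_⟩
  rw [hX, inv_mul_cancel_right₀ hpc']

/-- Inversion at the inserted point `p = f(a, b, c, d)` maps `a, b, d, c` to the vertices of a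
parallelogram. -/
theorem parallelogram_of_insertFactor {a b c d p : ℍ[ℝ]} (hab : a ≠ b) (hac : a ≠ c)
    (hbc : b ≠ c) (hbd : b ≠ d) (hcd : c ≠ d)
    (hneg : ¬ ((crossRatio c a b d).im = 0 ∧ (crossRatio c a b d).re < 0))
    (hp : insertFactor a b c d * (p - c) = b - p) :
    (a - p ≠ 0 ∧ b - p ≠ 0 ∧ c - p ≠ 0 ∧ d - p ≠ 0) ∧
      (a - p)⁻¹ + (d - p)⁻¹ = (b - p)⁻¹ + (c - p)⁻¹ := by
  have hSS := quatSqrt_mul_self hneg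
  have hSre := quatSqrt_re_nonneg (crossRatio c a b d)
  rw [insertFactor] at hp
  have hg' := mul_inv_mul_crossRatio (d := d) hab hac
  have hg0 : (b - a) * (c - a)⁻¹ ≠ 0 :=
    mul_ne_zero (sub_ne_zero.2 hab.symm) (inv_ne_zero (sub_ne_zero.2 hac.symm))
  have hcr : (b - a) * (c - a)⁻¹ * crossRatio c a b d ≠ 0 := by
    rw [hg']
    exact mul_ne_zero (sub_ne_zero.2 hbd) (inv_ne_zero (sub_ne_zero.2 hcd))
  generalize quatSqrt (crossRatio c a b d) = S at *
  have hS0 : S ≠ 0 := by rintro rfl; rw [← hSS] at hcr; simp at hcr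
  have hS1 : S ≠ -1 := by rintro rfl; norm_num at hSre
  rw [← hSS] at hg'
  generalize hg : (b - a) * (c - a)⁻¹ = g at *
  have hpc : p ≠ c := by
    rintro rfl
    rw [sub_self, mul_zero] at hp
    exact hbc (sub_eq_zero.1 hp.symm)
  have hpb : p ≠ b := by
    rintro rfl
    rw [sub_self] at hp
    exact (mul_ne_zero (mul_ne_zero hg0 hS0) (sub_ne_zero.2 hbc)) hp
  have hpc' := sub_ne_zero.2 hpc
  have hX : g * S = (b - p) * (p - c)⁻¹ := by rw [← hp, mul_inv_cancel_right₀ hpc']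
  have hpa : p ≠ a := by
    rintro rfl
    apply hS1
    apply mul_left_cancel₀ hg0
    rw [hX, ← hg, ← neg_sub c p, inv_neg, mul_neg, mul_neg, mul_one]
  have hpd : p ≠ d := by
    rintro rfl
    apply hS1
    apply mul_left_cancel₀ (mul_ne_zero hg0 hS0)
    rw [mul_assoc, hg', hX, ← neg_sub c p, inv_neg, mul_neg, mul_neg, mul_one, neg_neg]
  have ha0 : a - p ≠ 0 := sub_ne_zero.2 hpa.symm
  have hb0 : b - p ≠ 0 := sub_ne_zero.2 hpb.symm
  have hc0 : c - p ≠ 0 := sub_ne_zero.2 hpc.symm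
  have hd0 : d - p ≠ 0 := sub_ne_zero.2 hpd.symm
  refine ⟨⟨ha0, hb0, hc0, hd0⟩, ?_⟩
  -- The equation for `p` in terms of differences with `p`.
  have main : (b - p) * (c - p)⁻¹ * ((c - a) * (b - a)⁻¹) * ((b - p) * (c - p)⁻¹)
      = (b - d) * (c - d)⁻¹ := by
    have hgi : (c - a) * (b - a)⁻¹ = g⁻¹ := by rw [← hg, mul_inv_rev, inv_inv]
    have hX' : (b - p) * (c - p)⁻¹ = -(g * S) := by
      rw [hX, ← neg_sub c p, inv_neg, mul_neg, neg_neg]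
    rw [hgi, hX', ← hg']
    simp only [neg_mul, mul_neg, neg_neg, mul_assoc, inv_mul_cancel_left₀ hg0]
  -- Rewrite both sides in terms of the inverses.
  have hA : (c - a) * (b - a)⁻¹
      = (c - p) * (((a - p)⁻¹ - (c - p)⁻¹) * ((a - p)⁻¹ - (b - p)⁻¹)⁻¹) * (b - p)⁻¹ := by
    have e1 : (a - p)⁻¹ - (c - p)⁻¹ = (c - p)⁻¹ * (c - a) * (a - p)⁻¹ := by
      rw [← neg_sub, inv_sub_inv' hc0 ha0]; noncomm_ring
    have e2 : (a - p)⁻¹ - (b - p)⁻¹ = (b - p)⁻¹ * (b - a) * (a - p)⁻¹ := by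
      rw [← neg_sub, inv_sub_inv' hb0 ha0]; noncomm_ring
    rw [e1, e2]
    simp only [mul_inv_rev, inv_inv, mul_assoc, inv_mul_cancel_left₀ ha0,
      mul_inv_cancel_left₀ hc0, mul_inv_cancel₀ hb0, mul_one]
  have hD : (b - d) * (c - d)⁻¹
      = (b - p) * (((d - p)⁻¹ - (b - p)⁻¹) * ((d - p)⁻¹ - (c - p)⁻¹)⁻¹) * (c - p)⁻¹ := by
    have e1 : (d - p)⁻¹ - (c - p)⁻¹ = (c - p)⁻¹ * (c - d) * (d - p)⁻¹ := by
      rw [← neg_sub, inv_sub_inv' hc0 hd0]; noncomm_ring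
    have e2 : (d - p)⁻¹ - (b - p)⁻¹ = (b - p)⁻¹ * (b - d) * (d - p)⁻¹ := by
      rw [← neg_sub, inv_sub_inv' hb0 hd0]; noncomm_ring
    rw [e1, e2]
    simp only [mul_inv_rev, inv_inv, mul_assoc, inv_mul_cancel_left₀ hd0,
      mul_inv_cancel_left₀ hb0, mul_inv_cancel₀ hc0, mul_one]
  have hAB : (a - p)⁻¹ - (b - p)⁻¹ ≠ 0 := by
    rw [sub_ne_zero]; intro h; exact hab (sub_left_injective (inv_injective h))
  have hDC : (d - p)⁻¹ - (c - p)⁻¹ ≠ 0 := by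
    rw [sub_ne_zero]; intro h; exact hcd (sub_left_injective (inv_injective h)).symm
  have hBC : (b - p)⁻¹ - (c - p)⁻¹ ≠ 0 := by
    rw [sub_ne_zero]; intro h; exact hbc (sub_left_injective (inv_injective h))
  rw [hA, hD] at main
  have main2 : ((a - p)⁻¹ - (c - p)⁻¹) * ((a - p)⁻¹ - (b - p)⁻¹)⁻¹
      = ((d - p)⁻¹ - (b - p)⁻¹) * ((d - p)⁻¹ - (c - p)⁻¹)⁻¹ := by
    simp only [mul_assoc, inv_mul_cancel_left₀ hb0, inv_mul_cancel_left₀ hc0] at main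
    have := mul_left_cancel₀ hb0 main
    simpa only [← mul_assoc, mul_left_inj' (inv_ne_zero hc0)] using this
  generalize (a - p)⁻¹ = A at *
  generalize (b - p)⁻¹ = B at *
  generalize (c - p)⁻¹ = C at *
  generalize (d - p)⁻¹ = D at *
  have h3 : (B - C) * (A - B)⁻¹ = (B - C) * (-(D - C)⁻¹) := by
    have l1 : (A - C) * (A - B)⁻¹ = 1 + (B - C) * (A - B)⁻¹ := by
      rw [← sub_add_sub_cancel A B C, add_mul, mul_inv_cancel₀ hAB]
    have l2 : (D - B) * (D - C)⁻¹ = 1 + (B - C) * (-(D - C)⁻¹) := by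
      rw [← sub_sub_sub_cancel_right D B C, sub_mul (D - C), mul_inv_cancel₀ hDC]; noncomm_ring
    rw [l1, l2] at main2
    exact add_left_cancel main2
  have h4 := mul_left_cancel₀ hBC h3
  rw [← inv_neg] at h4
  have h5 := inv_injective h4
  rw [neg_sub, sub_eq_sub_iff_add_eq_add] at h5
  rw [h5, add_comm]

/-! ### The four inserted points after inversion -/

/-- The characterization of inserted points by cross-ratios, in the picture inverted at a point `q`
and with the origin of the inverted picture moved to `o`. -/
theorem IsInsertedPoint.of_inversion {a b c d p q : E3} {o A B C D P : ℍ[ℝ]}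
    (hd : a ≠ b ∧ a ≠ c ∧ a ≠ d ∧ b ≠ c ∧ b ≠ d ∧ c ≠ d)
    (hA : o + A ≠ 0) (hB : o + B ≠ 0) (hC : o + C ≠ 0) (hD : o + D ≠ 0) (hP : o + P ≠ 0)
    (ha : toQuat a = toQuat q + (o + A)⁻¹) (hb : toQuat b = toQuat q + (o + B)⁻¹)
    (hc : toQuat c = toQuat q + (o + C)⁻¹) (hdd : toQuat d = toQuat q + (o + D)⁻¹)
    (hp : toQuat p = toQuat q + (o + P)⁻¹)
    (hsq : crossRatio C A B P * crossRatio C A B P = crossRatio C A B D)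
    (hre : (crossRatio C A B P).re < 0) : IsInsertedPoint a b c d p := by
  have e1 : crossRatio (toQuat c) (toQuat a) (toQuat b) (toQuat p)
      = (o + C)⁻¹ * crossRatio C A B P * (o + C) := by
    rw [ha, hb, hc, hp, crossRatio_add_left, crossRatio_inv hC hA hB hP, crossRatio_add_left]
  have e2 : crossRatio (toQuat c) (toQuat a) (toQuat b) (toQuat d)
      = (o + C)⁻¹ * crossRatio C A B D * (o + C) := by
    rw [ha, hb, hc, hdd, crossRatio_add_left, crossRatio_inv hC hA hB hD, crossRatio_add_left]
  refine .of_crossRatio hd ?_ ?_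
  · rw [e1, e2, ← hsq]
    simp only [mul_assoc, mul_inv_cancel_left₀ hC]
  · rwa [e1, re_conj_mul hC]

theorem re_inv (q : ℍ[ℝ]) : (q⁻¹).re = (‖q‖ ^ 2)⁻¹ * q.re := by
  rw [Quaternion.instInv]
  simp only []
  rw [Quaternion.re_smul, Quaternion.re_star, Quaternion.normSq_eq_norm_mul_self, sq, smul_eq_mul]

theorem re_add_mul_inv_sub_neg {v w : ℍ[ℝ]} (h : ‖w‖ < ‖v‖) : ((w + v) * (w - v)⁻¹).re < 0 := by
  have hne : w - v ≠ 0 := by rw [sub_ne_zero]; rintro rfl; exact lt_irrefl _ h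
  have h1 : ((w + v) * star (w - v)).re = ‖w‖ ^ 2 - ‖v‖ ^ 2 := by
    rw [norm_sq_eq_components, norm_sq_eq_components]
    simp [Quaternion.re_mul]; ring
  have h2 : ((w + v) * (w - v)⁻¹).re = (‖w - v‖ ^ 2)⁻¹ * (‖w‖ ^ 2 - ‖v‖ ^ 2) := by
    rw [← h1, Quaternion.instInv]
    simp only []
    rw [mul_smul_comm, Quaternion.re_smul, Quaternion.normSq_eq_norm_mul_self, sq, smul_eq_mul]
  rw [h2]
  have := norm_nonneg w
  exact mul_neg_of_pos_of_neg (by positivity) (by nlinarith)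

/-- If inversion at `p` maps `a, b, c, d` to `o + w, o + v, o - v, o - w`, then the inserted points
other than `p` are the images of `o` and `o ± g`, where `g = √(w v⁻¹) v` is the geometric mean of
`v` and `w`. -/
theorem isInsertedPoint_of_parallelogram {a b c d p pab pcd pda : E3} {o v w σ : ℍ[ℝ]}
    (hab : a ≠ b) (hac : a ≠ c) (had : a ≠ d) (hbc : b ≠ c) (hbd : b ≠ d) (hcd : c ≠ d)
    (hA : o + w ≠ 0) (hB : o + v ≠ 0) (hC : o + -v ≠ 0) (hD : o + -w ≠ 0) (ho : o ≠ 0)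
    (hog : o + σ * v ≠ 0) (hog' : o + -(σ * v) ≠ 0)
    (ha : toQuat a = toQuat p + (o + w)⁻¹) (hb : toQuat b = toQuat p + (o + v)⁻¹)
    (hc : toQuat c = toQuat p + (o + -v)⁻¹) (hd : toQuat d = toQuat p + (o + -w)⁻¹)
    (hpab : toQuat pab = toQuat p + (o + σ * v)⁻¹)
    (hpcd : toQuat pcd = toQuat p + (o + -(σ * v))⁻¹)
    (hpda : toQuat pda = toQuat p + o⁻¹)
    (hσ : 0 < σ.re) (hσw : σ * σ = w * v⁻¹) (hlt : ‖w‖ < ‖v‖) :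
    IsInsertedPoint d a b c pab ∧ IsInsertedPoint b c d a pcd ∧ IsInsertedPoint c d a b pda := by
  have hv : v ≠ 0 := norm_pos_iff.1 ((norm_nonneg w).trans_lt hlt)
  have hw : w = σ * σ * v := by rw [hσw, inv_mul_cancel_right₀ hv]
  have hσ0 : σ ≠ 0 := by rintro rfl; simp at hσ
  have hσ1 : σ - 1 ≠ 0 := by
    rw [sub_ne_zero]; rintro rfl; rw [hw] at hlt; simp at hlt
  have hneg : (-((2 : ℝ)⁻¹ • (σ + σ⁻¹))).re < 0 := by
    have : σ⁻¹.re = (‖σ‖ ^ 2)⁻¹ * σ.re := re_inv σ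
    have h2 : 0 < (‖σ‖ ^ 2)⁻¹ * σ.re := by positivity
    rw [Quaternion.re_neg, Quaternion.re_smul, Quaternion.re_add, this, smul_eq_mul]
    linarith
  have htwo (q : ℍ[ℝ]) : (q + q)⁻¹ = (2 : ℝ)⁻¹ • q⁻¹ := by
    rw [← two_smul ℝ q, smul_inv₀]
  have hvw : v + w = (1 + σ * σ) * v := by rw [hw, add_mul, one_mul]
  have hww : (w + w)⁻¹ = (2 : ℝ)⁻¹ • (v⁻¹ * (σ⁻¹ * σ⁻¹)) := by
    rw [htwo, hw, mul_inv_rev, mul_inv_rev]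
  have hwg : w - σ * v = σ * ((σ - 1) * v) := by rw [hw]; noncomm_ring
  have hgv : σ * v - v = (σ - 1) * v := by noncomm_ring
  have k1 : (1 + σ * σ) * σ⁻¹ = σ + σ⁻¹ := by
    rw [add_mul, one_mul, mul_inv_cancel_right₀ hσ0, add_comm]
  have k2 : σ⁻¹ * (1 + σ * σ) = σ + σ⁻¹ := by
    rw [mul_add, mul_one, inv_mul_cancel_left₀ hσ0, add_comm]
  refine ⟨?_, ?_, ?_⟩
  · have hX : crossRatio v (-w) w (σ * v) = -((2 : ℝ)⁻¹ • (σ + σ⁻¹)) := by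
      rw [crossRatio, sub_neg_eq_add, ← neg_add', inv_neg, hww, hvw, hwg, hgv, mul_inv_rev, ← k1]
      simp only [mul_neg, neg_mul, mul_smul_comm, smul_mul_assoc, mul_assoc,
        mul_inv_cancel_left₀ hv, inv_mul_cancel_left₀ hσ0, mul_inv_cancel₀ hσ1, mul_one]
    refine .of_inversion ⟨had.symm, hbd.symm, hcd.symm, hab, hac, hbc⟩ hD hA hB hC hog
      hd ha hb hc hpab ?_ ?_
    · rw [hX, crossRatio, sub_neg_eq_add, ← neg_add', inv_neg, hww, sub_neg_eq_add, ← neg_add',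
        inv_neg, htwo, add_comm w v, hvw]
      rw [neg_mul_neg, smul_mul_smul_comm]
      conv_lhs => rw [← k1]
      conv_lhs => enter [2, 2]; rw [k1, ← k2]
      simp only [mul_neg, neg_mul, mul_smul_comm, smul_mul_assoc, mul_assoc, neg_neg, smul_neg,
        smul_smul, mul_inv_cancel_left₀ hv, mul_inv_cancel₀ hv, mul_one]
    · rw [hX]; exact hneg
  · have hX : crossRatio (-w) v (-v) (-(σ * v)) = -((2 : ℝ)⁻¹ • (σ + σ⁻¹)) := by
      rw [crossRatio, sub_neg_eq_add, htwo, ← neg_add', add_comm w v, hvw, neg_sub_neg, neg_sub_neg,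
        hwg, hgv, mul_inv_rev, mul_inv_rev, ← k1]
      simp only [smul_neg, neg_mul, mul_smul_comm, smul_mul_assoc, mul_assoc,
        mul_inv_cancel_left₀ hv, mul_inv_cancel_left₀ hσ1]
    refine .of_inversion ⟨hbc, hbd, hab.symm, hcd, hac.symm, had.symm⟩ hB hC hD hA hog'
      hb hc hd ha hpcd ?_ ?_
    · rw [hX, crossRatio, sub_neg_eq_add, htwo, sub_neg_eq_add, hww, ← neg_add', ← neg_add',
        add_comm w v, hvw]
      rw [neg_mul_neg, smul_mul_smul_comm, ← k1]
      have k3 : σ⁻¹ * ((1 + σ * σ) * σ⁻¹) = (1 + σ * σ) * (σ⁻¹ * σ⁻¹) := by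
        rw [← mul_assoc, k2, ← k1, mul_assoc]
      simp only [mul_neg, neg_mul, mul_smul_comm, smul_mul_assoc, mul_assoc, neg_neg, smul_neg,
        smul_smul, mul_inv_cancel_left₀ hv, k3]
    · rw [hX]; exact hneg
  · have hX : crossRatio w (-v) (-w) 0 = (w + v) * (w - v)⁻¹ := by
      have hw0 : w ≠ 0 := by rw [hw]; simp [hσ0, hv]
      rw [crossRatio, sub_zero, zero_sub, mul_assoc, mul_assoc,
        mul_inv_cancel₀ (neg_ne_zero.2 hw0), mul_one, sub_neg_eq_add, neg_sub_neg]
    refine .of_inversion (o := o) (P := 0) ⟨hcd, hac.symm, hbc.symm, had.symm, hbd.symm, hab⟩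
      hC hD hA hB (by simpa using ho) hc hd ha hb (by simpa using hpda) ?_ ?_
    · rw [hX, crossRatio, sub_neg_eq_add, neg_sub_neg, ← neg_sub w v, inv_neg, ← neg_add']
      simp only [mul_assoc, neg_mul, mul_neg, neg_neg]
    · rw [hX]; exact re_add_mul_inv_sub_neg hlt

/-! ### The curvature circle as the inverse of a line -/

/-- The inverse `z⁻¹ = -z / |z|²` of an imaginary quaternion, as a map of `ℝ³`. -/
noncomputable def negInv (z : E3) : E3 := -((‖z‖ ^ 2)⁻¹ • z)

theorem norm_toQuat (v : E3) : ‖toQuat v‖ = ‖v‖ := by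
  have h : ‖toQuat v‖ ^ 2 = ‖v‖ ^ 2 := by
    rw [norm_sq_eq_components, EuclideanSpace.norm_sq_eq, Fin.sum_univ_three]
    simp
  exact (sq_eq_sq₀ (norm_nonneg _) (norm_nonneg _)).1 h

theorem toQuat_negInv (z : E3) : toQuat (negInv z) = (toQuat z)⁻¹ := by
  have h : star (toQuat z) = -toQuat z := Quaternion.star_eq_neg.2 rfl
  rw [Quaternion.instInv]
  simp only []
  rw [Quaternion.normSq_eq_norm_mul_self, norm_toQuat, ← sq, h, negInv, toQuat_neg, toQuat_smul,
    smul_neg]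

theorem inner_negInv_left (z w : E3) : inner ℝ (negInv z) w = -((‖z‖ ^ 2)⁻¹ * inner ℝ z w) := by
  rw [negInv, inner_neg_left, real_inner_smul_left]

theorem norm_negInv_sq {z : E3} (hz : z ≠ 0) : ‖negInv z‖ ^ 2 = (‖z‖ ^ 2)⁻¹ := by
  have := norm_pos_iff.2 hz
  rw [negInv, norm_neg, norm_smul, Real.norm_of_nonneg (by positivity)]
  field_simp

theorem add_smul_ne_zero {n g : E3} (hng : inner ℝ n g = 0) (hn : n ≠ 0) (τ : ℝ) :
    n + τ • g ≠ 0 := by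
  intro h
  have h1 : inner ℝ n (n + τ • g) = 0 := by rw [h, inner_zero_right]
  rw [inner_add_right, real_inner_smul_right, hng, mul_zero, add_zero] at h1
  exact hn (inner_self_eq_zero.1 h1)

theorem dist_negInv_line {n g : E3} (hng : inner ℝ n g = 0) (hn : n ≠ 0) (p : E3) (τ : ℝ) :
    dist (p + negInv (n + τ • g)) (p - (2 * ‖n‖ ^ 2)⁻¹ • n) = (2 * ‖n‖)⁻¹ := by
  have hz := add_smul_ne_zero hng hn τ
  have hn' := norm_pos_iff.2 hn
  have hin : inner ℝ (n + τ • g) n = ‖n‖ ^ 2 := by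
    rw [inner_add_left, real_inner_smul_left, real_inner_comm, real_inner_comm n g, hng,
      real_inner_self_eq_norm_sq]
    ring
  have hz' := norm_pos_iff.2 hz
  rw [dist_eq_norm, ← sq_eq_sq₀ (norm_nonneg _) (by positivity),
    show p + negInv (n + τ • g) - (p - (2 * ‖n‖ ^ 2)⁻¹ • n)
      = negInv (n + τ • g) + (2 * ‖n‖ ^ 2)⁻¹ • n by abel, norm_add_sq_real, norm_negInv_sq hz,
    real_inner_smul_right, inner_negInv_left, hin, norm_smul, Real.norm_of_nonneg (by positivity)]
  field_simp
  ring

/-- The points `p`, `p + (n + τ g)⁻¹` for `τ = t + 1, t - 1, t`. -/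
def linePoints (p n g : E3) (t : ℝ) : Set E3 :=
  {p + negInv (n + (t + 1) • g), p, p + negInv (n + (t - 1) • g), p + negInv (n + t • g)}

theorem vectorSpan_linePoints {n g : E3} (hng : inner ℝ n g = 0) (hn : n ≠ 0) (p : E3) (t : ℝ) :
    vectorSpan ℝ (linePoints p n g t) = Submodule.span ℝ {n, g} := by
  rw [vectorSpan_eq_span_vsub_set_right ℝ (p := p) (by simp [linePoints])]
  have hnm : n ∈ Submodule.span ℝ {n, g} := Submodule.subset_span (by simp)
  have hgm : g ∈ Submodule.span ℝ {n, g} := Submodule.subset_span (by simp)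
  have hline (τ : ℝ) : negInv (n + τ • g) ∈ Submodule.span ℝ {n, g} :=
    neg_mem (Submodule.smul_mem _ _ (add_mem hnm (Submodule.smul_mem _ _ hgm)))
  apply le_antisymm <;> rw [Submodule.span_le]
  · rintro _ ⟨q, hq, rfl⟩
    rcases hq with rfl | rfl | rfl | rfl
    · simpa using hline (t + 1)
    · simp
    · simpa using hline (t - 1)
    · simpa using hline t
  · set W := Submodule.span ℝ ((fun x => x -ᵥ p) '' linePoints p n g t)
    have hback (τ : ℝ) (h : p + negInv (n + τ • g) ∈ linePoints p n g t) : n + τ • g ∈ W := by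
      have h1 : negInv (n + τ • g) ∈ W := Submodule.subset_span ⟨_, h, by simp⟩
      have h2 : n + τ • g = (-‖n + τ • g‖ ^ 2) • negInv (n + τ • g) := by
        have := norm_pos_iff.2 (add_smul_ne_zero hng hn τ)
        rw [negInv, smul_neg, smul_smul, ← neg_smul, neg_mul, neg_neg,
          mul_inv_cancel₀ (by positivity), one_smul]
      rw [h2]
      exact Submodule.smul_mem _ _ h1
    have h0 := hback t (by simp [linePoints])
    have h1 := hback (t + 1) (by simp [linePoints])
    have hg : g ∈ W := by
      have : g = (n + (t + 1) • g) - (n + t • g) := by module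
      rw [this]; exact sub_mem h1 h0
    have hn : n ∈ W := by
      have : n = (n + t • g) - t • g := by module
      rw [this]; exact sub_mem h0 (Submodule.smul_mem _ _ hg)
    rintro q (rfl | rfl)
    exacts [hn, hg]

theorem isCircleThrough_linePoints {n g : E3} (hng : inner ℝ n g = 0) (hn : n ≠ 0) (hg : g ≠ 0)
    (p : E3) (t : ℝ) :
    IsCircleThrough (linePoints p n g t) (p - (2 * ‖n‖ ^ 2)⁻¹ • n) (2 * ‖n‖)⁻¹ := by
  have hn' := norm_pos_iff.2 hn
  refine ⟨by positivity, ?_, ?_, ?_⟩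
  · intro q hq
    rcases hq with rfl | rfl | rfl | rfl
    · exact dist_negInv_line hng hn p _
    · rw [dist_eq_norm, sub_sub_cancel, norm_smul, Real.norm_of_nonneg (by positivity)]
      field_simp
    · exact dist_negInv_line hng hn p _
    · exact dist_negInv_line hng hn p _
  · have hp : p ∈ affineSpan ℝ (linePoints p n g t) := mem_affineSpan ℝ (by simp [linePoints])
    rw [← AffineSubspace.vsub_left_mem_direction_iff_mem hp, direction_affineSpan,
      vectorSpan_linePoints hng hn]
    simp only [vsub_eq_sub, sub_sub_cancel]
    exact Submodule.smul_mem _ _ (Submodule.subset_span (by simp))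
  · rw [vectorSpan_linePoints hng hn]
    have hli : LinearIndependent ℝ ![n, g] := by
      rw [LinearIndependent.pair_iff]
      intro α β h
      have h1 : inner ℝ n (α • n + β • g) = 0 := by rw [h, inner_zero_right]
      have h2 : inner ℝ g (α • n + β • g) = 0 := by rw [h, inner_zero_right]
      rw [inner_add_right, real_inner_smul_right, real_inner_smul_right, hng] at h1
      rw [inner_add_right, real_inner_smul_right, real_inner_smul_right, real_inner_comm, hng] at h2
      simpa [hn, hg] using And.intro h1 h2
    have := finrank_span_eq_card hli
    rwa [Matrix.range_cons_cons_empty, Fintype.card_fin] at this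

/-- The center and the radius of a circle are determined by a set of points that spans its plane. -/
theorem IsCircleThrough.unique {S : Set E3} {m m' : E3} {r r' : ℝ} (hS : S.Nonempty)
    (h : IsCircleThrough S m r) (h' : IsCircleThrough S m' r') : m = m' ∧ r = r' := by
  obtain ⟨p, hp⟩ := hS
  have hmem : m' - m ∈ vectorSpan ℝ S := by
    rw [← direction_affineSpan]
    exact AffineSubspace.vsub_mem_direction h'.center_mem h.center_mem
  have horth : vectorSpan ℝ S ≤ (ℝ ∙ (m' - m))ᗮ := by
    rw [vectorSpan_eq_span_vsub_set_right ℝ hp, Submodule.span_le]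
    rintro _ ⟨q, hq, rfl⟩
    rw [SetLike.mem_coe, Submodule.mem_orthogonal_singleton_iff_inner_right]
    have e (q : E3) (hq : q ∈ S) :
        ‖q - m'‖ ^ 2 = ‖q - m‖ ^ 2 - 2 * inner ℝ (q - m) (m' - m) + ‖m' - m‖ ^ 2 := by
      rw [← norm_sub_sq_real, sub_sub_sub_cancel_right]
    have e1 := e p hp
    have e2 := e q hq
    rw [← dist_eq_norm, ← dist_eq_norm, h.dist_eq _ hp, h'.dist_eq _ hp] at e1
    rw [← dist_eq_norm, ← dist_eq_norm, h.dist_eq _ hq, h'.dist_eq _ hq] at e2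
    have e3 : inner ℝ (q - p) (m' - m) = inner ℝ (q - m) (m' - m) - inner ℝ (p - m) (m' - m) := by
      rw [← inner_sub_left, sub_sub_sub_cancel_right]
    change inner ℝ (m' - m) (q - p) = 0
    rw [real_inner_comm, e3]
    linarith
  have h0 := horth hmem
  rw [Submodule.mem_orthogonal_singleton_iff_inner_right, inner_self_eq_zero, sub_eq_zero] at h0
  exact ⟨h0.symm, by rw [← h.dist_eq p hp, ← h'.dist_eq p hp, h0]⟩

theorem IsInsertedPoint.unique {a b c d p q : E3} (hp : IsInsertedPoint a b c d p)
    (hq : IsInsertedPoint a b c d q) : p = q :=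
  toQuat_injective (hp.eq.trans hq.eq.symm)

/-- A unit vector of the plane of `n` and `g` that is orthogonal to `n` and points to the side
of `g` is `g / |g|`. -/
theorem eq_normalize {n g e T : E3} (hng : inner ℝ n g = 0) (hn : n ≠ 0)
    (hT : T ∈ Submodule.span ℝ {n, g}) (hTn : inner ℝ T n = 0) (hT1 : ‖T‖ = 1)
    (he : 0 < inner ℝ g e) (hTe : 0 < inner ℝ T e) : T = ‖g‖⁻¹ • g := by
  obtain ⟨α, β, rfl⟩ := Submodule.mem_span_pair.1 hT
  rw [inner_add_left, real_inner_smul_left, real_inner_smul_left, real_inner_comm n g, hng,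
    mul_zero, add_zero, mul_eq_zero, inner_self_eq_zero] at hTn
  obtain rfl : α = 0 := hTn.resolve_right hn
  rw [zero_smul, zero_add] at *
  rw [real_inner_smul_left] at hTe
  have hβ : 0 < β := pos_of_mul_pos_left hTe he.le
  rw [norm_smul, Real.norm_of_nonneg hβ.le] at hT1
  rw [← eq_inv_of_mul_eq_one_left hT1]

/-- The discrete Frenet frame, if inversion at `pbc` maps the four inserted points to the line
`n + τ g`. -/
theorem isDiscreteFrenetFrame_iff {γ : ℤ → E3} {i : ℤ} {p n g : E3} {t : ℝ}
    (hng : inner ℝ n g = 0) (hn : n ≠ 0) (he : 0 < inner ℝ g (γ (i + 1) - γ i))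
    (hab : IsInsertedPoint (γ (i + 2)) (γ (i - 1)) (γ i) (γ (i + 1))
      (p + negInv (n + (t + 1) • g)))
    (hbc : IsInsertedPoint (γ (i - 1)) (γ i) (γ (i + 1)) (γ (i + 2)) p)
    (hcd : IsInsertedPoint (γ i) (γ (i + 1)) (γ (i + 2)) (γ (i - 1))
      (p + negInv (n + (t - 1) • g)))
    (hda : IsInsertedPoint (γ (i + 1)) (γ (i + 2)) (γ (i - 1)) (γ i) (p + negInv (n + t • g)))
    (G : Frame3) :
    IsDiscreteFrenetFrame γ i G ↔
      G = ⟨‖g‖⁻¹ • g, -(‖n‖⁻¹ • n), cross (‖g‖⁻¹ • g) (-(‖n‖⁻¹ • n))⟩ := by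
  have hg : g ≠ 0 := by rintro rfl; simp at he
  have hn' := norm_pos_iff.2 hn
  have hg' := norm_pos_iff.2 hg
  have hcirc := isCircleThrough_linePoints hng hn hg p t
  have hspan := vectorSpan_linePoints hng hn p t
  have hN : ((2 * ‖n‖)⁻¹)⁻¹ • (p - (2 * ‖n‖ ^ 2)⁻¹ • n - p) = -(‖n‖⁻¹ • n) := by
    rw [sub_sub_cancel_left, smul_neg, smul_smul]
    congr 2
    field_simp
  constructor
  · rintro ⟨pab, pbc, pcd, pda, m, r, h1, h2, h3, h4, hc, hT1, hT, hTn, hTe, hGN, hGB⟩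
    obtain rfl := h1.unique hab
    obtain rfl := h2.unique hbc
    obtain rfl := h3.unique hcd
    obtain rfl := h4.unique hda
    obtain ⟨rfl, rfl⟩ := hc.unique ⟨_, Set.mem_insert _ _⟩ hcirc
    have hT' : G.T = ‖g‖⁻¹ • g := by
      refine eq_normalize hng hn (hspan ▸ hT) ?_ hT1 he hTe
      rw [sub_sub_cancel, real_inner_smul_right] at hTn
      exact (mul_eq_zero.1 hTn).resolve_left (by positivity)
    rw [hN] at hGN
    rw [hGN, hT'] at hGB
    exact Frame3.ext hT' hGN hGB
  · rintro rfl
    refine ⟨_, _, _, _, _, _, hab, hbc, hcd, hda, hcirc, ?_, ?_, ?_, ?_, hN.symm, rfl⟩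
    · rw [norm_smul, norm_inv, norm_norm, inv_mul_cancel₀ hg'.ne']
    · change _ ∈ vectorSpan ℝ (linePoints p n g t)
      rw [hspan]
      exact Submodule.smul_mem _ _ (Submodule.subset_span (by simp))
    · rw [sub_sub_cancel, real_inner_smul_left, real_inner_smul_right,
        real_inner_comm n g, hng]
      simp
    · rw [real_inner_smul_left]
      positivity

/-! ### Asymptotic calculus with quaternions -/

section Calculus

variable {l : Filter ℝ} {φ : ℝ → ℝ}

theorem isBigO_mul_sub_mul {f₁ f₂ g₁ g₂ : ℝ → ℍ[ℝ]}
    (h₁ : (fun ε => f₁ ε - g₁ ε) =O[l] φ) (h₂ : (fun ε => f₂ ε - g₂ ε) =O[l] φ)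
    (hf : f₁ =O[l] fun _ => (1 : ℝ)) (hg : g₂ =O[l] fun _ => (1 : ℝ)) :
    (fun ε => f₁ ε * f₂ ε - g₁ ε * g₂ ε) =O[l] φ := by
  have e1 : (fun ε => f₁ ε * (f₂ ε - g₂ ε)) =O[l] φ := by simpa using hf.mul h₂
  have e2 : (fun ε => (f₁ ε - g₁ ε) * g₂ ε) =O[l] φ := by simpa using h₁.mul hg
  refine (e1.add e2).congr_left fun ε => ?_
  noncomm_ring

theorem isBigO_inv_sub_inv {f g : ℝ → ℍ[ℝ]} {c : ℍ[ℝ]} (hc : c ≠ 0)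
    (h : (fun ε => f ε - g ε) =O[l] φ) (hf : Tendsto f l (𝓝 c)) (hg : Tendsto g l (𝓝 c)) :
    (fun ε => (f ε)⁻¹ - (g ε)⁻¹) =O[l] φ := by
  have h1 := (hf.inv₀ hc).isBigO_one ℝ
  have h2 := (hg.inv₀ hc).isBigO_one ℝ
  have e : (fun ε => (f ε)⁻¹ * (f ε - g ε) * (g ε)⁻¹) =O[l] φ := by
    simpa using (h1.mul h).mul h2
  refine e.neg_left.congr' ?_ .rfl
  filter_upwards [hf.eventually_ne hc, hg.eventually_ne hc] with ε hf0 hg0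
  rw [inv_sub_inv' hf0 hg0]
  noncomm_ring

theorem tendsto_of_isBigO_sub {E : Type*} [NormedAddCommGroup E] {f g : ℝ → E} {c : E}
    (hφ : Tendsto φ l (𝓝 0)) (h : (fun ε => f ε - g ε) =O[l] φ) (hg : Tendsto g l (𝓝 c)) :
    Tendsto f l (𝓝 c) := by
  simpa using (h.trans_tendsto hφ).add hg

/-- The principal square root near a positive real `k²`: the factorization
`(√q - k) (√q + k) = q - k²` has a second factor of norm at least `k`. -/
theorem isBigO_quatSqrt_sub {q : ℝ → ℍ[ℝ]} {k : ℝ} (hk : 0 < k) (hφ : Tendsto φ l (𝓝 0))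
    (h : (fun ε => q ε - (k ^ 2) • (1 : ℍ[ℝ])) =O[l] φ) :
    (fun ε => quatSqrt (q ε) - k • (1 : ℍ[ℝ])) =O[l] φ := by
  have hq : Tendsto q l (𝓝 ((k ^ 2) • (1 : ℍ[ℝ]))) :=
    tendsto_of_isBigO_sub (g := fun _ => (k ^ 2) • (1 : ℍ[ℝ])) hφ h tendsto_const_nhds
  have hre : ∀ᶠ ε in l, 0 < (q ε).re := by
    have := (Quaternion.continuous_re.tendsto _).comp hq
    refine this.eventually (lt_mem_nhds ?_)
    simp [hk]
  refine IsBigO.trans (.of_bound k⁻¹ ?_) h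
  filter_upwards [hre] with ε hε
  have hSS : quatSqrt (q ε) * quatSqrt (q ε) = q ε := quatSqrt_mul_self fun h => by linarith [h.2]
  have hS := quatSqrt_re_nonneg (q ε)
  generalize quatSqrt (q ε) = S at *
  have h1 : (S - k • (1 : ℍ[ℝ])) * (S + k • (1 : ℍ[ℝ])) = q ε - (k ^ 2) • (1 : ℍ[ℝ]) := by
    rw [← hSS, sq, sub_mul, mul_add, mul_add]
    simp only [mul_smul_comm, smul_mul_assoc, mul_one, one_mul, smul_smul]
    abel
  have h2 : k ≤ ‖S + k • (1 : ℍ[ℝ])‖ := by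
    refine le_trans ?_ ((le_abs_self _).trans (abs_re_le_norm _))
    simp [hS]
  rw [← h1, norm_mul, inv_mul_eq_div, le_div_iff₀ hk]
  exact mul_le_mul_of_nonneg_left h2 (norm_nonneg _)

end Calculus

/-! ### Inversion of a pair of points that is almost symmetric -/

/-- The midpoint of the inverses of `ε (-x + ε r)` and `ε (x + ε r)` is `- x⁻¹ r x⁻¹` with an
explicit error term, since it equals `(x + ε r)⁻¹ r (-x + ε r)⁻¹`. -/
theorem inv_add_inv_eq {x r : ℍ[ℝ]} {ε : ℝ} (hε : ε ≠ 0) (hx : x ≠ 0) (h1 : x + ε • r ≠ 0)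
    (h2 : -x + ε • r ≠ 0) :
    (2 : ℝ)⁻¹ • ((ε • (-x + ε • r))⁻¹ + (ε • (x + ε • r))⁻¹) + x⁻¹ * r * x⁻¹
      = ε ^ 2 • ((x + ε • r)⁻¹ * (r * x⁻¹ * r * x⁻¹ * r) * (-x + ε • r)⁻¹) := by
  have e1 : (2 : ℝ)⁻¹ • ((ε • (-x + ε • r))⁻¹ + (ε • (x + ε • r))⁻¹)
      = (x + ε • r)⁻¹ * r * (-x + ε • r)⁻¹ := by
    have : (-x + ε • r)⁻¹ + (x + ε • r)⁻¹
        = (x + ε • r)⁻¹ * ((2 * ε) • r) * (-x + ε • r)⁻¹ := by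
      have : (2 * ε) • r = (x + ε • r) + (-x + ε • r) := by module
      rw [this, mul_add, add_mul, inv_mul_cancel₀ h1, one_mul, mul_assoc, mul_inv_cancel₀ h2,
        mul_one]
    rw [smul_inv₀, smul_inv₀, ← smul_add, this, smul_smul, mul_smul_comm, smul_mul_assoc, smul_smul]
    rw [show (2 : ℝ)⁻¹ * ε⁻¹ * (2 * ε) = 1 by field_simp, one_smul]
  have e2 : (x + ε • r) * (x⁻¹ * r * x⁻¹) * (-x + ε • r)
      = -r + ε ^ 2 • (r * x⁻¹ * r * x⁻¹ * r) := by
    simp only [mul_add, add_mul, mul_smul_comm, smul_mul_assoc, mul_assoc, mul_one, mul_neg,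
      inv_mul_cancel₀ hx, mul_inv_cancel_left₀ hx]
    module
  have e3 : x⁻¹ * r * x⁻¹
      = (x + ε • r)⁻¹ * (-r + ε ^ 2 • (r * x⁻¹ * r * x⁻¹ * r)) * (-x + ε • r)⁻¹ := by
    rw [← e2]
    simp only [mul_assoc, inv_mul_cancel_left₀ h1, mul_inv_cancel₀ h2, mul_one]
  rw [e1, e3, ← add_mul, ← mul_add, add_neg_cancel_left, mul_smul_comm, smul_mul_assoc]

theorem inv_sub_inv_eq {x r : ℍ[ℝ]} {ε : ℝ} (hε : ε ≠ 0) (hx : x ≠ 0) (h1 : x + ε • r ≠ 0)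
    (h2 : -x + ε • r ≠ 0) :
    ε • ((2 : ℝ)⁻¹ • ((ε • (-x + ε • r))⁻¹ - (ε • (x + ε • r))⁻¹))
      = (ε ^ 2 • (r * x⁻¹ * r) - x)⁻¹ := by
  have e1 : (-x + ε • r)⁻¹ - (x + ε • r)⁻¹ = (x + ε • r)⁻¹ * ((2 : ℝ) • x) * (-x + ε • r)⁻¹ := by
    have : (2 : ℝ) • x = (x + ε • r) - (-x + ε • r) := by module
    rw [this, mul_sub, sub_mul, inv_mul_cancel₀ h1, one_mul, mul_assoc, mul_inv_cancel₀ h2,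
      mul_one]
  have e2 : ε ^ 2 • (r * x⁻¹ * r) - x = (-x + ε • r) * x⁻¹ * (x + ε • r) := by
    simp only [mul_add, add_mul, mul_smul_comm, smul_mul_assoc, mul_assoc, neg_mul,
      mul_inv_cancel_left₀ hx, inv_mul_cancel₀ hx, mul_one, smul_add, smul_smul, smul_neg]
    module
  rw [smul_inv₀, smul_inv₀, ← smul_sub, e1, e2, mul_inv_rev, mul_inv_rev, inv_inv, mul_smul_comm,
    smul_mul_assoc, smul_smul, smul_smul, smul_smul, ← mul_assoc]
  rw [show ε * (2 : ℝ)⁻¹ * ε⁻¹ * 2 = 1 by field_simp, one_smul]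

section Pair

variable {x r : ℝ → ℍ[ℝ]} {x₀ : ℍ[ℝ]}

theorem tendsto_id_punctured : Tendsto (fun ε : ℝ => ε) (𝓝[≠] 0) (𝓝 0) :=
  tendsto_id.mono_left nhdsWithin_le_nhds

theorem tendsto_sq_punctured : Tendsto (fun ε : ℝ => ε ^ 2) (𝓝[≠] 0) (𝓝 0) := by
  simpa using tendsto_id_punctured.pow 2

theorem tendsto_add_smul (hx : Tendsto x (𝓝[≠] 0) (𝓝 x₀))
    (hr : r =O[𝓝[≠] 0] fun _ => (1 : ℝ)) :
    Tendsto (fun ε => x ε + ε • r ε) (𝓝[≠] 0) (𝓝 x₀) := by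
  have : (fun ε => ε • r ε) =O[𝓝[≠] 0] fun ε : ℝ => ε := by
    simpa using (isBigO_refl (fun ε : ℝ => ε) (𝓝[≠] 0)).smul hr
  simpa using hx.add (this.trans_tendsto tendsto_id_punctured)

/-- The midpoint of the inverses of `ε (-x + ε r)` and `ε (x + ε r)`. The error is of second order,
since the terms of first order cancel. -/
theorem isBigO_inv_add_inv (h0 : x₀ ≠ 0) (hx : Tendsto x (𝓝[≠] 0) (𝓝 x₀))
    (hr : r =O[𝓝[≠] 0] fun _ => (1 : ℝ)) :
    (fun ε => (2 : ℝ)⁻¹ • ((ε • (-x ε + ε • r ε))⁻¹ + (ε • (x ε + ε • r ε))⁻¹)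
      + (x ε)⁻¹ * r ε * (x ε)⁻¹) =O[𝓝[≠] 0] fun ε => ε ^ 2 := by
  have t1 := tendsto_add_smul hx hr
  have t2 := tendsto_add_smul hx.neg hr
  have i0 := (hx.inv₀ h0).isBigO_one ℝ
  have i1 := (t1.inv₀ h0).isBigO_one ℝ
  have i2 := (t2.inv₀ (neg_ne_zero.2 h0)).isBigO_one ℝ
  have h := (isBigO_refl (fun ε : ℝ => ε ^ 2) (𝓝[≠] 0)).smul
    ((i1.mul ((((hr.mul i0).mul hr).mul i0).mul hr)).mul i2)
  simp only [mul_one, smul_eq_mul] at h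
  refine h.congr' ?_ .rfl
  filter_upwards [self_mem_nhdsWithin, hx.eventually_ne h0, t1.eventually_ne h0,
    t2.eventually_ne (neg_ne_zero.2 h0)] with ε hε e0 e1 e2
  exact (inv_add_inv_eq hε e0 e1 e2).symm

/-- Half the difference of the inverses of `ε (-x + ε r)` and `ε (x + ε r)`, scaled by `ε`. -/
theorem isBigO_inv_sub_inv_pair (h0 : x₀ ≠ 0) (hx : Tendsto x (𝓝[≠] 0) (𝓝 x₀))
    (hr : r =O[𝓝[≠] 0] fun _ => (1 : ℝ)) :
    (fun ε => ε • ((2 : ℝ)⁻¹ • ((ε • (-x ε + ε • r ε))⁻¹ - (ε • (x ε + ε • r ε))⁻¹))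
      + (x ε)⁻¹) =O[𝓝[≠] 0] fun ε => ε ^ 2 := by
  have t1 := tendsto_add_smul hx hr
  have t2 := tendsto_add_smul hx.neg hr
  have h0' := neg_ne_zero.2 h0
  have i0 := (hx.inv₀ h0).isBigO_one ℝ
  have h : (fun ε => (ε ^ 2 • (r ε * (x ε)⁻¹ * r ε) - x ε) - -x ε) =O[𝓝[≠] 0]
      fun ε => ε ^ 2 := by
    have h := (isBigO_refl (fun ε : ℝ => ε ^ 2) (𝓝[≠] 0)).smul ((hr.mul i0).mul hr)
    simp only [mul_one, smul_eq_mul] at h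
    simpa using h
  refine (isBigO_inv_sub_inv h0' h (tendsto_of_isBigO_sub tendsto_sq_punctured h hx.neg)
    hx.neg).congr' ?_ .rfl
  filter_upwards [self_mem_nhdsWithin, hx.eventually_ne h0, t1.eventually_ne h0,
    t2.eventually_ne h0'] with ε hε e0 e1 e2
  rw [inv_sub_inv_eq hε e0 e1 e2, inv_neg, sub_neg_eq_add]

end Pair

/-! ### Expansion of the inserted point -/

/-- Four points `m ± ε x + ε² y` and `m ± ε x₃ + ε² y₃` that depend on a parameter `ε ≠ 0`, where
`x₃ = 3 x + O(ε²)` and `y₃ = 9 y + O(ε²)`, as for the values of a smooth curve at the parameters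
`± ε` and `± 3 ε`. -/
structure EdgeExpansion (a b c d m x y x₃ y₃ : ℝ → ℍ[ℝ]) (x₀ y₀ : ℍ[ℝ]) : Prop where
  ha : ∀ ε ≠ 0, a ε = m ε + ε • (-x₃ ε + ε • y₃ ε)
  hb : ∀ ε ≠ 0, b ε = m ε + ε • (-x ε + ε • y ε)
  hc : ∀ ε ≠ 0, c ε = m ε + ε • (x ε + ε • y ε)
  hd : ∀ ε ≠ 0, d ε = m ε + ε • (x₃ ε + ε • y₃ ε)
  x_ne : x₀ ≠ 0
  tendsto_x : Tendsto x (𝓝[≠] 0) (𝓝 x₀)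
  tendsto_y : Tendsto y (𝓝[≠] 0) (𝓝 y₀)
  hx₃ : (fun ε => x₃ ε - (3 : ℝ) • x ε) =O[𝓝[≠] 0] fun ε : ℝ => ε ^ 2
  hy₃ : (fun ε => y₃ ε - (9 : ℝ) • y ε) =O[𝓝[≠] 0] fun ε : ℝ => ε ^ 2

theorem isBigO_sq_id : (fun ε : ℝ => ε ^ 2) =O[𝓝[≠] 0] fun ε : ℝ => ε := by
  have h := (isBigO_refl (fun ε : ℝ => ε) (𝓝[≠] 0)).mul (tendsto_id_punctured.isBigO_one ℝ)
  simpa [sq] using h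

theorem isBigO_smul_id {f : ℝ → ℍ[ℝ]} (hf : f =O[𝓝[≠] 0] fun _ => (1 : ℝ)) :
    (fun ε => ε • f ε) =O[𝓝[≠] 0] fun ε : ℝ => ε := by
  simpa using (isBigO_refl (fun ε : ℝ => ε) (𝓝[≠] 0)).smul hf

theorem one_add_one_quat_ne_zero : (1 + 1 : ℍ[ℝ]) ≠ 0 := by
  intro h
  have := congrArg (fun q : ℍ[ℝ] => q.re) h
  simp only [Quaternion.re_add, Quaternion.re_one, Quaternion.re_zero] at this
  norm_num at this

/-- A ratio of differences that are of exact order `ε`. -/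
theorem isBigO_ratio {f g F G x : ℝ → ℍ[ℝ]} {x₀ : ℍ[ℝ]} {α β : ℝ} (hx₀ : x₀ ≠ 0) (hβ : β ≠ 0)
    (hx : Tendsto x (𝓝[≠] 0) (𝓝 x₀)) (hf : ∀ ε ≠ 0, f ε = ε • F ε) (hg : ∀ ε ≠ 0, g ε = ε • G ε)
    (hF : (fun ε => F ε - α • x ε) =O[𝓝[≠] 0] fun ε : ℝ => ε)
    (hG : (fun ε => G ε - β • x ε) =O[𝓝[≠] 0] fun ε : ℝ => ε) :
    (fun ε => f ε * (g ε)⁻¹ - (α / β) • (1 : ℍ[ℝ])) =O[𝓝[≠] 0] fun ε : ℝ => ε := by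
  have hβx : Tendsto (fun ε => β • x ε) (𝓝[≠] 0) (𝓝 (β • x₀)) := hx.const_smul β
  have hαx : Tendsto (fun ε => α • x ε) (𝓝[≠] 0) (𝓝 (α • x₀)) := hx.const_smul α
  have h0 : β • x₀ ≠ 0 := smul_ne_zero hβ hx₀
  have hGt := tendsto_of_isBigO_sub tendsto_id_punctured hG hβx
  have hFt := tendsto_of_isBigO_sub tendsto_id_punctured hF hαx
  have h1 := isBigO_inv_sub_inv h0 hG hGt hβx
  have h2 := isBigO_mul_sub_mul hF h1 (hFt.isBigO_one ℝ) ((hβx.inv₀ h0).isBigO_one ℝ)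
  refine h2.congr' ?_ .rfl
  filter_upwards [self_mem_nhdsWithin, hx.eventually_ne hx₀] with ε hε hxε
  rw [hf ε hε, hg ε hε, smul_inv₀, smul_inv₀, smul_mul_smul_comm, smul_mul_smul_comm,
    mul_inv_cancel₀ hxε, mul_inv_cancel₀ hε, one_smul, div_eq_mul_inv]

namespace EdgeExpansion

variable {a b c d m x y x₃ y₃ : ℝ → ℍ[ℝ]} {x₀ y₀ : ℍ[ℝ]}

theorem tendsto_x₃ (h : EdgeExpansion a b c d m x y x₃ y₃ x₀ y₀) :
    Tendsto x₃ (𝓝[≠] 0) (𝓝 ((3 : ℝ) • x₀)) :=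
  tendsto_of_isBigO_sub tendsto_sq_punctured h.hx₃ (h.tendsto_x.const_smul _)

theorem tendsto_y₃ (h : EdgeExpansion a b c d m x y x₃ y₃ x₀ y₀) :
    Tendsto y₃ (𝓝[≠] 0) (𝓝 ((9 : ℝ) • y₀)) :=
  tendsto_of_isBigO_sub tendsto_sq_punctured h.hy₃ (h.tendsto_y.const_smul _)

/-- The differences of the four points are `ε` times combinations of this form. -/
theorem isBigO_comb (h : EdgeExpansion a b c d m x y x₃ y₃ x₀ y₀) (s t k : ℝ) :
    (fun ε => (s • x₃ ε + t • x ε + ε • (k • (y₃ ε - y ε))) - (3 * s + t) • x ε)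
      =O[𝓝[≠] 0] fun ε : ℝ => ε := by
  have e1 := (h.hx₃.trans isBigO_sq_id).const_smul_left s
  have e2 := isBigO_smul_id (((h.tendsto_y₃.sub h.tendsto_y).const_smul k).isBigO_one ℝ)
  refine (e1.add e2).congr_left fun ε => ?_
  simp only [Pi.smul_apply]
  module

theorem ne_of_comb (h : EdgeExpansion a b c d m x y x₃ y₃ x₀ y₀) {f g : ℝ → ℍ[ℝ]} (s t k : ℝ)
    (hst : 3 * s + t ≠ 0)
    (hfg : ∀ ε ≠ 0, f ε - g ε = ε • (s • x₃ ε + t • x ε + ε • (k • (y₃ ε - y ε)))) :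
    ∀ᶠ ε in 𝓝[≠] 0, f ε ≠ g ε := by
  have ht := tendsto_of_isBigO_sub tendsto_id_punctured (h.isBigO_comb s t k)
    (h.tendsto_x.const_smul (3 * s + t))
  filter_upwards [self_mem_nhdsWithin, ht.eventually_ne (smul_ne_zero hst h.x_ne)] with ε hε h0
  rw [← sub_ne_zero, hfg ε hε]
  exact smul_ne_zero hε h0

theorem sub_ba (h : EdgeExpansion a b c d m x y x₃ y₃ x₀ y₀) :
    ∀ ε ≠ 0, b ε - a ε
      = ε • ((1 : ℝ) • x₃ ε + (-1 : ℝ) • x ε + ε • ((-1 : ℝ) • (y₃ ε - y ε))) := by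
  intro ε hε; rw [h.ha ε hε, h.hb ε hε]; module

theorem sub_ab (h : EdgeExpansion a b c d m x y x₃ y₃ x₀ y₀) :
    ∀ ε ≠ 0, a ε - b ε
      = ε • ((-1 : ℝ) • x₃ ε + (1 : ℝ) • x ε + ε • ((1 : ℝ) • (y₃ ε - y ε))) := by
  intro ε hε; rw [h.ha ε hε, h.hb ε hε]; module

theorem sub_ca (h : EdgeExpansion a b c d m x y x₃ y₃ x₀ y₀) :
    ∀ ε ≠ 0, c ε - a ε
      = ε • ((1 : ℝ) • x₃ ε + (1 : ℝ) • x ε + ε • ((-1 : ℝ) • (y₃ ε - y ε))) := by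
  intro ε hε; rw [h.ha ε hε, h.hc ε hε]; module

theorem sub_bd (h : EdgeExpansion a b c d m x y x₃ y₃ x₀ y₀) :
    ∀ ε ≠ 0, b ε - d ε
      = ε • ((-1 : ℝ) • x₃ ε + (-1 : ℝ) • x ε + ε • ((-1 : ℝ) • (y₃ ε - y ε))) := by
  intro ε hε; rw [h.hb ε hε, h.hd ε hε]; module

theorem sub_dc (h : EdgeExpansion a b c d m x y x₃ y₃ x₀ y₀) :
    ∀ ε ≠ 0, d ε - c ε
      = ε • ((1 : ℝ) • x₃ ε + (-1 : ℝ) • x ε + ε • ((1 : ℝ) • (y₃ ε - y ε))) := by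
  intro ε hε; rw [h.hd ε hε, h.hc ε hε]; module

theorem sub_cb (h : EdgeExpansion a b c d m x y x₃ y₃ x₀ y₀) :
    ∀ ε ≠ 0, c ε - b ε
      = ε • ((0 : ℝ) • x₃ ε + (2 : ℝ) • x ε + ε • ((0 : ℝ) • (y₃ ε - y ε))) := by
  intro ε hε; rw [h.hb ε hε, h.hc ε hε]; module

theorem sub_da (h : EdgeExpansion a b c d m x y x₃ y₃ x₀ y₀) :
    ∀ ε ≠ 0, d ε - a ε
      = ε • ((2 : ℝ) • x₃ ε + (0 : ℝ) • x ε + ε • ((0 : ℝ) • (y₃ ε - y ε))) := by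
  intro ε hε; rw [h.ha ε hε, h.hd ε hε]; module

theorem eventually_distinct (h : EdgeExpansion a b c d m x y x₃ y₃ x₀ y₀) :
    ∀ᶠ ε in 𝓝[≠] 0, a ε ≠ b ε ∧ a ε ≠ c ε ∧ a ε ≠ d ε ∧ b ε ≠ c ε ∧ b ε ≠ d ε ∧ c ε ≠ d ε := by
  filter_upwards [h.ne_of_comb _ _ _ (by norm_num) h.sub_ab,
    h.ne_of_comb _ _ _ (by norm_num) h.sub_ca, h.ne_of_comb _ _ _ (by norm_num) h.sub_da,
    h.ne_of_comb _ _ _ (by norm_num) h.sub_cb, h.ne_of_comb _ _ _ (by norm_num) h.sub_bd,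
    h.ne_of_comb _ _ _ (by norm_num) h.sub_dc] with ε h1 h2 h3 h4 h5 h6
  exact ⟨h1, h2.symm, h3.symm, h4.symm, h5, h6.symm⟩

/-- The limit is the cross-ratio `4` of the points `1, -3, -1, 3` on a line. -/
theorem isBigO_crossRatio (h : EdgeExpansion a b c d m x y x₃ y₃ x₀ y₀) :
    (fun ε => crossRatio (c ε) (a ε) (b ε) (d ε) - ((2 : ℝ) ^ 2) • (1 : ℍ[ℝ]))
      =O[𝓝[≠] 0] fun ε : ℝ => ε := by
  have h1 := isBigO_ratio h.x_ne (by norm_num) h.tendsto_x h.sub_ca h.sub_ab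
    (h.isBigO_comb _ _ _) (h.isBigO_comb _ _ _)
  have h2 := isBigO_ratio h.x_ne (by norm_num) h.tendsto_x h.sub_bd h.sub_dc
    (h.isBigO_comb _ _ _) (h.isBigO_comb _ _ _)
  have t1 := tendsto_of_isBigO_sub tendsto_id_punctured h1 tendsto_const_nhds
  refine (isBigO_mul_sub_mul h1 h2 (t1.isBigO_one ℝ)
    (tendsto_const_nhds.isBigO_one ℝ)).congr_left fun ε => ?_
  rw [crossRatio, smul_mul_smul_comm, mul_assoc, mul_assoc, mul_assoc, mul_one]
  norm_num

theorem eventually_not_neg (h : EdgeExpansion a b c d m x y x₃ y₃ x₀ y₀) :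
    ∀ᶠ ε in 𝓝[≠] 0, ¬ ((crossRatio (c ε) (a ε) (b ε) (d ε)).im = 0 ∧
      (crossRatio (c ε) (a ε) (b ε) (d ε)).re < 0) := by
  have ht := tendsto_of_isBigO_sub tendsto_id_punctured h.isBigO_crossRatio tendsto_const_nhds
  have := (Quaternion.continuous_re.tendsto _).comp ht
  filter_upwards [this.eventually (lt_mem_nhds (a := 0) (by simp))] with ε hε h
  exact absurd h.2 (not_lt.2 (le_of_lt hε))

/-- The factor `(b - a) (c - a)⁻¹ √cr` tends to `1/2 · 2 = 1`. -/
theorem isBigO_insertFactor (h : EdgeExpansion a b c d m x y x₃ y₃ x₀ y₀) :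
    (fun ε => insertFactor (a ε) (b ε) (c ε) (d ε) - 1) =O[𝓝[≠] 0] fun ε : ℝ => ε := by
  have h1 := isBigO_ratio h.x_ne (by norm_num) h.tendsto_x h.sub_ba h.sub_ca
    (h.isBigO_comb _ _ _) (h.isBigO_comb _ _ _)
  have h2 := isBigO_quatSqrt_sub two_pos tendsto_id_punctured h.isBigO_crossRatio
  have t1 := tendsto_of_isBigO_sub tendsto_id_punctured h1 tendsto_const_nhds
  refine (isBigO_mul_sub_mul h1 h2 (t1.isBigO_one ℝ)
    (tendsto_const_nhds.isBigO_one ℝ)).congr_left fun ε => ?_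
  rw [insertFactor, smul_mul_smul_comm]
  norm_num

theorem tendsto_insertFactor_add_one (h : EdgeExpansion a b c d m x y x₃ y₃ x₀ y₀) :
    Tendsto (fun ε => insertFactor (a ε) (b ε) (c ε) (d ε) + 1) (𝓝[≠] 0) (𝓝 (1 + 1)) :=
  (tendsto_of_isBigO_sub tendsto_id_punctured h.isBigO_insertFactor tendsto_const_nhds).add_const 1

theorem eventually_insertFactor_add_one_ne (h : EdgeExpansion a b c d m x y x₃ y₃ x₀ y₀) :
    ∀ᶠ ε in 𝓝[≠] 0, insertFactor (a ε) (b ε) (c ε) (d ε) + 1 ≠ 0 :=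
  h.tendsto_insertFactor_add_one.eventually_ne one_add_one_quat_ne_zero

/-- The distance of the inserted point from the midpoint of `b` and `c` is `O(ε²)`. -/
theorem exists_remainder (h : EdgeExpansion a b c d m x y x₃ y₃ x₀ y₀) :
    ∃ r : ℝ → ℍ[ℝ], r =O[𝓝[≠] 0] (fun _ => (1 : ℝ)) ∧ ∀ᶠ ε in 𝓝[≠] 0,
      insertPoint (a ε) (b ε) (c ε) (d ε) = m ε + ε ^ 2 • (y ε - r ε) := by
  refine ⟨fun ε => -((insertFactor (a ε) (b ε) (c ε) (d ε) + 1)⁻¹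
    * (ε⁻¹ • (insertFactor (a ε) (b ε) (c ε) (d ε) - 1)) * x ε), ?_, ?_⟩
  · have h1 := (h.tendsto_insertFactor_add_one.inv₀ one_add_one_quat_ne_zero).isBigO_one ℝ
    have h2 : (fun ε => ε⁻¹ • (insertFactor (a ε) (b ε) (c ε) (d ε) - 1))
        =O[𝓝[≠] 0] fun _ => (1 : ℝ) := by
      refine ((isBigO_refl (fun ε : ℝ => ε⁻¹) (𝓝[≠] 0)).smul h.isBigO_insertFactor).trans ?_
      refine (isBigO_refl _ _).congr' ?_ .rfl
      filter_upwards [self_mem_nhdsWithin] with ε hε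
      exact (inv_mul_cancel₀ hε).symm
    have h3 := (h1.mul h2).mul (h.tendsto_x.isBigO_one ℝ)
    simp only [mul_one] at h3
    exact h3.neg_left
  · filter_upwards [self_mem_nhdsWithin, h.eventually_insertFactor_add_one_ne] with ε hε h1
    symm
    rw [insertPoint_eq_iff h1]
    generalize insertFactor (a ε) (b ε) (c ε) (d ε) = X at *
    obtain ⟨q, hq⟩ : ∃ q, q = (X + 1)⁻¹ * (ε⁻¹ • (X - 1)) * x ε := ⟨_, rfl⟩
    rw [← hq]
    have e1 : (X + 1) * (ε • q) = (X - 1) * x ε := by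
      rw [hq, mul_smul_comm, mul_assoc, mul_inv_cancel_left₀ h1, smul_mul_assoc, smul_smul,
        mul_inv_cancel₀ hε, one_smul]
    have e2 : (X + 1) * (ε ^ 2 • q) = (X - 1) * (ε • x ε) := by
      rw [sq, mul_smul, mul_smul_comm, e1, mul_smul_comm]
    rw [add_mul, sub_mul, one_mul, one_mul] at e2
    rw [h.hb ε hε, h.hc ε hε]
    have e3 : X * (m ε + ε ^ 2 • (y ε - -q) - (m ε + ε • (x ε + ε • y ε)))
        = X * (ε ^ 2 • q) - X * (ε • x ε) := by
      rw [← mul_sub]; congr 1; module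
    have e4 : m ε + ε • (-x ε + ε • y ε) - (m ε + ε ^ 2 • (y ε - -q))
        = -(ε • x ε) - ε ^ 2 • q := by module
    rw [e3, e4, eq_sub_of_add_eq e2]
    abel

/-- The asymptotic form of the picture inverted at the inserted point `p`: the points `b, c` are
mapped to `o ± v` and the points `a, d` to `o ± w`. -/
theorem inverted_isBigO (h : EdgeExpansion a b c d m x y x₃ y₃ x₀ y₀) {p o v w : ℝ → ℍ[ℝ]}
    (hp : ∀ ε, p ε = insertPoint (a ε) (b ε) (c ε) (d ε))
    (ho : ∀ ε, o ε = (2 : ℝ)⁻¹ • ((b ε - p ε)⁻¹ + (c ε - p ε)⁻¹))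
    (hv : ∀ ε, v ε = (2 : ℝ)⁻¹ • ((b ε - p ε)⁻¹ - (c ε - p ε)⁻¹))
    (hw : ∀ ε, w ε = (2 : ℝ)⁻¹ • ((a ε - p ε)⁻¹ - (d ε - p ε)⁻¹)) :
    (fun ε => o ε + (x ε)⁻¹ * y ε * (x ε)⁻¹) =O[𝓝[≠] 0] (fun ε : ℝ => ε ^ 2) ∧
      (fun ε => ε • v ε + (x ε)⁻¹) =O[𝓝[≠] 0] (fun ε : ℝ => ε ^ 2) ∧
      (fun ε => ε • w ε + (3 : ℝ)⁻¹ • (x ε)⁻¹) =O[𝓝[≠] 0] (fun ε : ℝ => ε ^ 2) := by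
  obtain ⟨r, hr, hpr⟩ := h.exists_remainder
  have h3x₀ : (3 : ℝ) • x₀ ≠ 0 := smul_ne_zero (by norm_num) h.x_ne
  have hyO := h.tendsto_y.isBigO_one ℝ
  have hr₃ : (fun ε => r ε + (y₃ ε - y ε)) =O[𝓝[≠] 0] fun _ => (1 : ℝ) :=
    hr.add ((h.tendsto_y₃.sub h.tendsto_y).isBigO_one ℝ)
  have hi := isBigO_inv_sub_inv h3x₀ h.hx₃ h.tendsto_x₃ (h.tendsto_x.const_smul _)
  have hiO := (h.tendsto_x₃.inv₀ h3x₀).isBigO_one ℝ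
  have hxiO := (h.tendsto_x.inv₀ h.x_ne).isBigO_one ℝ
  have h3iO := ((h.tendsto_x.const_smul (3 : ℝ)).inv₀ h3x₀).isBigO_one ℝ
  -- The differences with `p`.
  have hsub : ∀ᶠ ε in 𝓝[≠] 0, b ε - p ε = ε • (-x ε + ε • r ε) ∧ c ε - p ε = ε • (x ε + ε • r ε) ∧
      a ε - p ε = ε • (-x₃ ε + ε • (r ε + (y₃ ε - y ε))) ∧
      d ε - p ε = ε • (x₃ ε + ε • (r ε + (y₃ ε - y ε))) := by
    filter_upwards [self_mem_nhdsWithin, hpr] with ε hε hpε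
    rw [hp, hpε, h.ha ε hε, h.hb ε hε, h.hc ε hε, h.hd ε hε]
    refine ⟨?_, ?_, ?_, ?_⟩ <;> module
  have hpar : ∀ᶠ ε in 𝓝[≠] 0,
      (a ε - p ε)⁻¹ + (d ε - p ε)⁻¹ = (b ε - p ε)⁻¹ + (c ε - p ε)⁻¹ := by
    filter_upwards [h.eventually_distinct, h.eventually_not_neg,
      h.eventually_insertFactor_add_one_ne] with ε ⟨h1, h2, h3, h4, h5, h6⟩ hn h0
    exact (parallelogram_of_insertFactor h1 h2 h4 h5 h6 hn ((insertPoint_eq_iff h0).1 (hp ε))).2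
  have ho₁ : (fun ε => o ε + (x ε)⁻¹ * r ε * (x ε)⁻¹) =O[𝓝[≠] 0] fun ε : ℝ => ε ^ 2 := by
    refine (isBigO_inv_add_inv h.x_ne h.tendsto_x hr).congr' ?_ .rfl
    filter_upwards [hsub] with ε ⟨e1, e2, _, _⟩
    rw [ho, e1, e2]
  have ho₃ : (fun ε => o ε + (x₃ ε)⁻¹ * (r ε + (y₃ ε - y ε)) * (x₃ ε)⁻¹)
      =O[𝓝[≠] 0] fun ε : ℝ => ε ^ 2 := by
    refine (isBigO_inv_add_inv h3x₀ h.tendsto_x₃ hr₃).congr' ?_ .rfl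
    filter_upwards [hsub, hpar] with ε ⟨_, _, e1, e2⟩ e3
    rw [ho, ← e3, e1, e2]
  -- Comparing the two expressions for `o` yields `9 r = r + 8 y + O(ε²)`.
  have hry : (fun ε => r ε - y ε) =O[𝓝[≠] 0] fun ε : ℝ => ε ^ 2 := by
    have k1 := isBigO_mul_sub_mul (isBigO_mul_sub_mul hi
      (isBigO_zero (fun ε : ℝ => ε ^ 2) _ |>.congr_left fun ε => (sub_self _).symm) hiO hr₃) hi
      (by simpa using hiO.mul hr₃) h3iO
    have k2 := (ho₁.sub ho₃).add k1
    have k3 : (fun ε => (x ε)⁻¹ * (r ε - (9 : ℝ)⁻¹ • (r ε + (y₃ ε - y ε))) * (x ε)⁻¹)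
        =O[𝓝[≠] 0] fun ε : ℝ => ε ^ 2 := by
      refine k2.congr_left fun ε => ?_
      simp only [smul_inv₀, mul_sub, sub_mul, smul_mul_assoc, mul_smul_comm, smul_smul]
      norm_num
    have k4 : (fun ε => r ε - (9 : ℝ)⁻¹ • (r ε + (y₃ ε - y ε)))
        =O[𝓝[≠] 0] fun ε : ℝ => ε ^ 2 := by
      have hxO := h.tendsto_x.isBigO_one ℝ
      have := (hxO.mul k3).mul hxO
      simp only [one_mul, mul_one] at this
      refine this.congr' ?_ .rfl
      filter_upwards [h.tendsto_x.eventually_ne h.x_ne] with ε hε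
      simp only [mul_assoc, inv_mul_cancel₀ hε, mul_one, mul_inv_cancel_left₀ hε]
    refine ((k4.add (h.hy₃.const_smul_left (9 : ℝ)⁻¹)).const_smul_left ((9 : ℝ) / 8)).congr_left
      fun ε => ?_
    simp only [Pi.smul_apply]
    module
  refine ⟨?_, ?_, ?_⟩
  · have k := (hxiO.mul hry).mul hxiO
    simp only [one_mul, mul_one] at k
    refine (ho₁.sub k).congr_left fun ε => ?_
    noncomm_ring
  · refine (isBigO_inv_sub_inv_pair h.x_ne h.tendsto_x hr).congr' ?_ .rfl
    filter_upwards [hsub] with ε ⟨e1, e2, _, _⟩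
    rw [hv, e1, e2]
  · have k : (fun ε => ε • w ε + (x₃ ε)⁻¹) =O[𝓝[≠] 0] fun ε : ℝ => ε ^ 2 := by
      refine (isBigO_inv_sub_inv_pair h3x₀ h.tendsto_x₃ hr₃).congr' ?_ .rfl
      filter_upwards [hsub] with ε ⟨_, _, e1, e2⟩
      rw [hw, e1, e2]
    refine (k.sub hi).congr_left fun ε => ?_
    rw [smul_inv₀]
    abel

end EdgeExpansion

/-! ### Symmetric differences of a smooth curve -/

section Taylor

theorem isBigO_punctured {E : Type*} [NormedAddCommGroup E] {f : ℝ → E} {g : ℝ → ℝ}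
    (h : f =O[𝓝 0] g) : f =O[𝓝[≠] 0] g :=
  h.mono nhdsWithin_le_nhds

variable {E : Type*} [NormedAddCommGroup E] [NormedSpace ℝ E]

/-- Taylor's theorem with a big-O remainder, along a linear reparametrization. -/
theorem isBigO_taylor {f : ℝ → E} {n : ℕ} (hf : ContDiff ℝ (n + 1) f) (u κ : ℝ) :
    (fun ε : ℝ => f (u + κ * ε) - taylorWithinEval f n Set.univ u (u + κ * ε))
      =O[𝓝 0] fun ε : ℝ => ε ^ (n + 1) := by
  have h1 := (taylor_isLittleO_univ (x₀ := u) (n := n + 1) (by exact_mod_cast hf)).isBigO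
  have h2 : (fun x => ((((n : ℝ) + 1) * n.factorial)⁻¹ * (x - u) ^ (n + 1)) •
      iteratedDerivWithin (n + 1) f Set.univ u) =O[𝓝 u] fun x => (x - u) ^ (n + 1) := by
    have := ((isBigO_refl (fun x => (x - u) ^ (n + 1)) (𝓝 u)).const_mul_left
      (((n : ℝ) + 1) * n.factorial)⁻¹).smul
      (isBigO_refl (fun _ : ℝ => iteratedDerivWithin (n + 1) f Set.univ u) (𝓝 u))
    refine this.trans (IsBigO.of_bound ‖iteratedDerivWithin (n + 1) f Set.univ u‖ ?_)
    filter_upwards with x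
    rw [norm_smul, mul_comm]
  have h3 := h1.add h2
  have ht : Tendsto (fun ε : ℝ => u + κ * ε) (𝓝 0) (𝓝 u) := by
    have : Continuous fun ε : ℝ => u + κ * ε := by fun_prop
    simpa using this.tendsto 0
  refine ((h3.comp_tendsto ht).trans ?_).congr_left fun ε => ?_
  · simp only [Function.comp_def, add_sub_cancel_left, mul_pow]
    exact (isBigO_refl _ _).const_mul_left _
  · simp only [Function.comp, taylorWithinEval_succ]
    abel

theorem isBigO_taylor_one {f : ℝ → E} (hf : ContDiff ℝ 2 f) (u κ : ℝ) :
    (fun ε : ℝ => f (u + κ * ε) - (f u + (κ * ε) • deriv f u)) =O[𝓝 0] fun ε : ℝ => ε ^ 2 := by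
  refine (isBigO_taylor (n := 1) (by exact_mod_cast hf) u κ).congr_left fun ε => ?_
  simp [taylor_within_apply, iteratedDerivWithin_univ]

theorem isBigO_taylor_two {f : ℝ → E} (hf : ContDiff ℝ 3 f) (u κ : ℝ) :
    (fun ε : ℝ => f (u + κ * ε) - (f u + (κ * ε) • deriv f u
      + ((κ * ε) ^ 2 / 2) • deriv (deriv f) u)) =O[𝓝 0] fun ε : ℝ => ε ^ 3 := by
  refine (isBigO_taylor (n := 2) (by exact_mod_cast hf) u κ).congr_left fun ε => ?_
  simp [taylor_within_apply, iteratedDerivWithin_univ, iteratedDeriv_succ,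
    div_eq_inv_mul]
  norm_num

theorem isBigO_taylor_three {f : ℝ → E} (hf : ContDiff ℝ 4 f) (u κ : ℝ) :
    (fun ε : ℝ => f (u + κ * ε) - (f u + (κ * ε) • deriv f u
      + ((κ * ε) ^ 2 / 2) • deriv (deriv f) u + ((κ * ε) ^ 3 / 6) • deriv (deriv (deriv f)) u))
      =O[𝓝 0] fun ε : ℝ => ε ^ 4 := by
  refine (isBigO_taylor (n := 3) (by exact_mod_cast hf) u κ).congr_left fun ε => ?_
  simp [taylor_within_apply, iteratedDerivWithin_univ, iteratedDeriv_succ,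
    div_eq_inv_mul, Nat.factorial]
  norm_num

theorem contDiff_deriv_of_succ {f : ℝ → E} {n : ℕ} (hf : ContDiff ℝ (n + 1) f) :
    ContDiff ℝ n (deriv f) := (contDiff_succ_iff_deriv.1 hf).2.2

/-- The symmetric first difference quotient of `f` with step `j ε` at `u + κ ε`. -/
noncomputable def symmSub (f : ℝ → E) (u κ j ε : ℝ) : E :=
  (2 * ε)⁻¹ • (f (u + (κ + j) * ε) - f (u + (κ - j) * ε))

/-- The symmetric second difference quotient of `f` with step `j ε` at `u + κ ε`. -/
noncomputable def symmAdd (f : ℝ → E) (u κ j ε : ℝ) : E :=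
  (2 * ε ^ 2)⁻¹ • (f (u + (κ + j) * ε) + f (u + (κ - j) * ε) - (2 : ℝ) • f (u + κ * ε))

theorem add_eq_symm (f : ℝ → E) (u κ j : ℝ) {ε : ℝ} (hε : ε ≠ 0) :
    f (u + (κ + j) * ε) = f (u + κ * ε) + ε • (symmSub f u κ j ε + ε • symmAdd f u κ j ε) := by
  rw [symmSub, symmAdd]
  match_scalars <;> field_simp <;> ring

theorem sub_eq_symm (f : ℝ → E) (u κ j : ℝ) {ε : ℝ} (hε : ε ≠ 0) :
    f (u + (κ - j) * ε) = f (u + κ * ε) + ε • (-symmSub f u κ j ε + ε • symmAdd f u κ j ε) := by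
  rw [symmSub, symmAdd]
  match_scalars <;> field_simp <;> ring

theorem tendsto_add_mul (u κ : ℝ) : Tendsto (fun ε : ℝ => u + κ * ε) (𝓝[≠] 0) (𝓝 u) := by
  have : Continuous fun ε : ℝ => u + κ * ε := by fun_prop
  simpa using (this.tendsto 0).mono_left nhdsWithin_le_nhds

/-- The symmetric first difference at the moving parameter `u + κ ε`. The second derivative drops
out by symmetry, so that the error is of second order. -/
theorem isBigO_symmSub {f : ℝ → E} (hf : ContDiff ℝ 4 f) (u κ j : ℝ) :
    (fun ε => symmSub f u κ j ε - j • deriv f (u + κ * ε)) =O[𝓝[≠] 0] fun ε : ℝ => ε ^ 2 := by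
  have hf3 : ContDiff ℝ 3 f := hf.of_le (by norm_num)
  have hf' : ContDiff ℝ 2 (deriv f) := contDiff_deriv_of_succ (n := 2) (by exact_mod_cast hf3)
  have h1 := (isBigO_taylor_two hf3 u (κ + j)).sub (isBigO_taylor_two hf3 u (κ - j))
  have h2 : (fun ε : ℝ => (2 * ε)⁻¹ • ((f (u + (κ + j) * ε) - (f u + ((κ + j) * ε) • deriv f u
      + (((κ + j) * ε) ^ 2 / 2) • deriv (deriv f) u)) - (f (u + (κ - j) * ε) -
      (f u + ((κ - j) * ε) • deriv f u + (((κ - j) * ε) ^ 2 / 2) • deriv (deriv f) u))))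
      =O[𝓝[≠] 0] fun ε : ℝ => ε ^ 2 := by
    refine ((isBigO_refl (fun ε : ℝ => (2 * ε)⁻¹) (𝓝[≠] 0)).smul
      (isBigO_punctured h1)).trans ?_
    refine ((isBigO_refl (fun ε : ℝ => ε ^ 2) (𝓝[≠] 0)).const_mul_left 2⁻¹).congr' ?_ .rfl
    filter_upwards [self_mem_nhdsWithin] with ε hε
    have : ε ≠ 0 := hε
    simp only [smul_eq_mul]
    field_simp
  have h3 := (isBigO_punctured (isBigO_taylor_one hf' u κ)).const_smul_left j
  refine (h2.sub h3).congr' ?_ .rfl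
  filter_upwards [self_mem_nhdsWithin] with ε hε
  have : ε ≠ 0 := hε
  simp only [Pi.smul_apply, symmSub]
  match_scalars <;> field_simp <;> ring

/-- The symmetric second difference at the moving parameter `u + κ ε`. The third derivative drops
out by symmetry, and the fourth order remainder leaves an error of second order. -/
theorem isBigO_symmAdd {f : ℝ → E} (hf : ContDiff ℝ 4 f) (u κ j : ℝ) :
    (fun ε => symmAdd f u κ j ε - (j ^ 2 / 2) • deriv (deriv f) (u + κ * ε))
      =O[𝓝[≠] 0] fun ε : ℝ => ε ^ 2 := by
  have hf' : ContDiff ℝ 3 (deriv f) := contDiff_deriv_of_succ (n := 3) (by exact_mod_cast hf)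
  have hf'' : ContDiff ℝ 2 (deriv (deriv f)) :=
    contDiff_deriv_of_succ (n := 2) (by exact_mod_cast hf')
  have h1 := ((isBigO_taylor_three hf u (κ + j)).add (isBigO_taylor_three hf u (κ - j))).sub
    ((isBigO_taylor_three hf u κ).const_smul_left (2 : ℝ))
  have h2 := (((isBigO_refl (fun ε : ℝ => (2 * ε ^ 2)⁻¹) (𝓝[≠] 0)).smul
      (isBigO_punctured h1)).trans (g := fun ε : ℝ => (2 * ε ^ 2)⁻¹ • ε ^ 4)
      (isBigO_refl _ _)).trans (k := fun ε : ℝ => ε ^ 2) (by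
    refine ((isBigO_refl (fun ε : ℝ => ε ^ 2) (𝓝[≠] 0)).const_mul_left 2⁻¹).congr' ?_ .rfl
    filter_upwards [self_mem_nhdsWithin] with ε hε
    have : ε ≠ 0 := hε
    simp only [smul_eq_mul]
    field_simp)
  have h3 := (isBigO_punctured (isBigO_taylor_one hf'' u κ)).const_smul_left (j ^ 2 / 2)
  refine (h2.sub h3).congr' ?_ .rfl
  filter_upwards [self_mem_nhdsWithin] with ε hε
  have : ε ≠ 0 := hε
  simp only [Pi.smul_apply, symmAdd]
  match_scalars <;> field_simp <;> ring

end Taylor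

/-! ### Vector algebra in `ℝ³` -/

/-- The imaginary part of a quaternion as a vector of `ℝ³`. -/
noncomputable def ofQuat (q : ℍ[ℝ]) : E3 := !₂[q.imI, q.imJ, q.imK]

theorem toQuat_ofQuat {q : ℍ[ℝ]} (hq : q.re = 0) : toQuat (ofQuat q) = q := by
  ext <;> simp [ofQuat, hq]

theorem ofQuat_toQuat (v : E3) : ofQuat (toQuat v) = v := toQuat_injective (toQuat_ofQuat rfl)

theorem toQuat_eq_zero_iff {v : E3} : toQuat v = 0 ↔ v = 0 := by
  rw [← norm_eq_zero, norm_toQuat, norm_eq_zero]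

/-- The component of `o` orthogonal to `g`. -/
noncomputable def perp (o g : E3) : E3 := o - (inner ℝ o g / ‖g‖ ^ 2) • g

theorem inner_perp (o : E3) {g : E3} (hg : g ≠ 0) : inner ℝ (perp o g) g = 0 := by
  have := norm_pos_iff.2 hg
  rw [perp, inner_sub_left, real_inner_smul_left, real_inner_self_eq_norm_sq]
  field_simp
  ring

theorem perp_smul_right (o g : E3) {k : ℝ} (hk : k ≠ 0) : perp o (k • g) = perp o g := by
  rcases eq_or_ne g 0 with rfl | hg
  · simp
  have := norm_pos_iff.2 hg
  rw [perp, perp, real_inner_smul_right, norm_smul, smul_smul]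
  congr 2
  rw [mul_pow, Real.norm_eq_abs, sq_abs]
  field_simp

theorem cross_cross_self (z y : E3) :
    cross (cross z y) z = (‖z‖ ^ 2) • y - (inner ℝ z y) • z := by
  rw [EuclideanSpace.norm_sq_eq, Fin.sum_univ_three]
  ext i
  fin_cases i <;>
    simp [cross, cross_apply, PiLp.inner_apply, Fin.sum_univ_three] <;> ring

theorem norm_cross_cross_self (z y : E3) : ‖cross (cross z y) z‖ = ‖cross z y‖ * ‖z‖ := by
  rw [← sq_eq_sq₀ (norm_nonneg _) (by positivity), mul_pow]
  simp only [EuclideanSpace.norm_sq_eq, Fin.sum_univ_three]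
  simp [cross, cross_apply]
  ring

theorem cross_smul_left (k : ℝ) (z y : E3) : cross (k • z) y = k • cross z y := by
  simp [cross]

theorem cross_smul_right (k : ℝ) (z y : E3) : cross z (k • y) = k • cross z y := by
  simp [cross]

theorem cross_cross_left (z y : E3) :
    cross z (cross (cross z y) z) = (‖z‖ ^ 2) • cross z y := by
  rw [EuclideanSpace.norm_sq_eq, Fin.sum_univ_three]
  ext i; fin_cases i <;> simp [cross, cross_apply] <;> ring

theorem ofQuat_conj (z y : E3) :
    ofQuat ((toQuat z)⁻¹ * toQuat y * (toQuat z)⁻¹)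
      = ((‖z‖ ^ 2)⁻¹ ^ 2) • ((‖z‖ ^ 2) • y - (2 * inner ℝ z y) • z) := by
  have h : star (toQuat z) = -toQuat z := Quaternion.star_eq_neg.2 rfl
  have h2 : (toQuat z)⁻¹ = -((‖z‖ ^ 2)⁻¹ • toQuat z) := by
    rw [← toQuat_negInv, negInv, toQuat_neg, toQuat_smul]
  rw [h2, neg_mul, neg_mul_neg, smul_mul_assoc, smul_mul_smul_comm, ← sq]
  generalize (‖z‖ ^ 2)⁻¹ ^ 2 = k
  rw [EuclideanSpace.norm_sq_eq, Fin.sum_univ_three]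
  ext i
  fin_cases i <;>
    simp [ofQuat, PiLp.inner_apply, Fin.sum_univ_three, Quaternion.imI_mul, Quaternion.imJ_mul,
      Quaternion.imK_mul, Quaternion.re_mul, -mul_eq_mul_left_iff] <;> ring

theorem perp_ofQuat_conj {z : E3} (hz : z ≠ 0) (y : E3) :
    perp (ofQuat ((toQuat z)⁻¹ * toQuat y * (toQuat z)⁻¹)) z
      = ((‖z‖ ^ 2)⁻¹ ^ 2) • cross (cross z y) z := by
  have := norm_pos_iff.2 hz
  rw [ofQuat_conj, cross_cross_self, perp, real_inner_smul_left, inner_sub_left,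
    real_inner_smul_left, real_inner_smul_left, real_inner_self_eq_norm_sq, real_inner_comm y z]
  match_scalars
  · ring
  · field_simp
    ring

/-! ### The smooth Frenet frame -/

/-- The vector of length one in the direction of `z` (zero for `z = 0`). -/
noncomputable def unitVec (z : E3) : E3 := ‖z‖⁻¹ • z

theorem unitVec_smul {k : ℝ} (hk : 0 < k) (z : E3) : unitVec (k • z) = unitVec z := by
  rw [unitVec, unitVec, norm_smul, Real.norm_of_nonneg hk.le, smul_smul]
  congr 1
  field_simp

theorem unitVec_smul_sign (ε : ℝ) (z : E3) : unitVec (ε • z) = Real.sign ε • unitVec z := by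
  rcases lt_trichotomy ε 0 with h | rfl | h
  · rw [Real.sign_of_neg h, ← neg_neg ε, neg_smul, ← smul_neg, unitVec_smul (by linarith),
      unitVec, unitVec, norm_neg]
    module
  · simp [unitVec]
  · rw [Real.sign_of_pos h, unitVec_smul h, one_smul]

theorem smoothN_eq_unitVec (s : ℝ → E3) (w : ℝ) :
    smoothN s w = unitVec (cross (cross (deriv s w) (deriv (deriv s) w)) (deriv s w)) := by
  rw [smoothN, smoothB, smoothT, unitVec, cross_smul_left, cross_smul_right, norm_cross_cross_self,
    smul_smul, mul_inv]

theorem smoothB_eq_cross (s : ℝ → E3) (w : ℝ) (hw : deriv s w ≠ 0) :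
    smoothB s w = cross (smoothT s w) (smoothN s w) := by
  have := norm_pos_iff.2 hw
  rw [smoothN, smoothT, smoothB]
  simp only [cross_smul_left, cross_smul_right, cross_cross_left, smul_smul]
  congr 1
  field_simp

/-! ### Stability of the vector operations -/

theorem isBigO_comp_sub {E F : Type*} [NormedAddCommGroup E] [NormedSpace ℝ E]
    [NormedAddCommGroup F] [NormedSpace ℝ F] {Φ : E → F} {x₀ : E} (hΦ : ContDiffAt ℝ 1 Φ x₀)
    {l : Filter ℝ} {φ : ℝ → ℝ} {f g : ℝ → E} (hf : Tendsto f l (𝓝 x₀)) (hg : Tendsto g l (𝓝 x₀))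
    (h : (fun ε => f ε - g ε) =O[l] φ) : (fun ε => Φ (f ε) - Φ (g ε)) =O[l] φ := by
  have h1 := (hΦ.hasStrictFDerivAt (by norm_num)).isBigO_sub
  exact (h1.comp_tendsto (hf.prodMk_nhds hg)).trans h

theorem contDiffAt_unitVec {z : E3} (hz : z ≠ 0) : ContDiffAt ℝ 1 unitVec z := by
  unfold unitVec
  exact ((contDiffAt_norm ℝ hz).inv (norm_ne_zero_iff.2 hz)).smul contDiffAt_id

theorem contDiffAt_perp {o g : E3} (hg : g ≠ 0) :
    ContDiffAt ℝ 1 (fun q : E3 × E3 => perp q.1 q.2) (o, g) := by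
  unfold perp
  have hn : ‖g‖ ^ 2 ≠ 0 := by simpa using hg
  have h1 : ContDiffAt ℝ 1 (fun q : E3 × E3 => inner ℝ q.1 q.2) (o, g) :=
    contDiffAt_fst.inner ℝ contDiffAt_snd
  have h2 : ContDiffAt ℝ 1 (fun q : E3 × E3 => ‖q.2‖ ^ 2) (o, g) := contDiffAt_snd.norm_sq ℝ
  exact contDiffAt_fst.sub ((h1.div h2 hn).smul contDiffAt_snd)

theorem contDiff_cross : ContDiff ℝ 1 (fun q : E3 × E3 => cross q.1 q.2) := by
  rw [contDiff_euclidean]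
  intro i
  fin_cases i <;> simp [cross, cross_apply] <;> fun_prop

theorem tendsto_unitVec {l : Filter ℝ} {f : ℝ → E3} {a : E3} (ha : a ≠ 0)
    (hf : Tendsto f l (𝓝 a)) : Tendsto (fun ε => unitVec (f ε)) l (𝓝 (unitVec a)) :=
  (contDiffAt_unitVec ha).continuousAt.tendsto.comp hf

theorem tendsto_cross {l : Filter ℝ} {f g : ℝ → E3} {a b : E3} (hf : Tendsto f l (𝓝 a))
    (hg : Tendsto g l (𝓝 b)) : Tendsto (fun ε => cross (f ε) (g ε)) l (𝓝 (cross a b)) := by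
  have h := contDiff_cross.continuous.tendsto (a, b)
  have h' := h.comp (hf.prodMk_nhds hg)
  simpa only [Function.comp_def] using h'

theorem perp_neg_left (o g : E3) : perp (-o) g = -perp o g := by
  simp only [perp, inner_neg_left]
  module

theorem unitVec_neg (z : E3) : unitVec (-z) = -unitVec z := by
  rw [unitVec, unitVec, norm_neg, smul_neg]

/-- If `ε Γ` agrees up to `O(ε²)` with a positive multiple of `s'`, and `O` with `- z⁻¹ y z⁻¹` for
`z = s'` and `y = s'' / 2`, then the frame built from the line through `O` in the direction `Γ`
agrees with the smooth Frenet frame up to `O(ε²)`: the component of `z⁻¹ y z⁻¹` orthogonal to `z` is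
a positive multiple of `(s' × s'') × s'`. -/
theorem frame_isBigO {s : ℝ → E3} {u κ k : ℝ} (hs : ContDiff ℝ 4 s)
    (hu : cross (deriv s u) (deriv (deriv s) u) ≠ 0) (hk : 0 < k) {O Γ : ℝ → E3}
    (hΓ : (fun ε => ε • Γ ε - (k * (‖deriv s (u + κ * ε)‖ ^ 2)⁻¹) • deriv s (u + κ * ε))
      =O[𝓝[≠] 0] fun ε : ℝ => ε ^ 2)
    (hO : (fun ε => O ε + ofQuat ((toQuat (deriv s (u + κ * ε)))⁻¹
        * toQuat ((1 / 2 : ℝ) • deriv (deriv s) (u + κ * ε)) * (toQuat (deriv s (u + κ * ε)))⁻¹))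
      =O[𝓝[≠] 0] fun ε : ℝ => ε ^ 2) :
    (fun ε => Real.sign ε • unitVec (Γ ε) - smoothT s (u + κ * ε))
        =O[𝓝[≠] 0] (fun ε : ℝ => ε ^ 2) ∧
      (fun ε => -unitVec (perp (O ε) (Γ ε)) - smoothN s (u + κ * ε))
        =O[𝓝[≠] 0] (fun ε : ℝ => ε ^ 2) ∧
      (fun ε => Real.sign ε • cross (unitVec (Γ ε)) (-unitVec (perp (O ε) (Γ ε)))
        - smoothB s (u + κ * ε)) =O[𝓝[≠] 0] (fun ε : ℝ => ε ^ 2) ∧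
      (∀ᶠ ε in 𝓝[≠] 0, perp (O ε) (Γ ε) ≠ 0) := by
  have hs' : ContDiff ℝ 3 (deriv s) := contDiff_deriv_of_succ (n := 3) (by exact_mod_cast hs)
  have hs'' : ContDiff ℝ 2 (deriv (deriv s)) :=
    contDiff_deriv_of_succ (n := 2) (by exact_mod_cast hs')
  have hz := (hs'.continuous.tendsto u).comp (tendsto_add_mul u κ)
  have hy := (hs''.continuous.tendsto u).comp (tendsto_add_mul u κ)
  have hT (ε : ℝ) : smoothT s (u + κ * ε) = unitVec (deriv s (u + κ * ε)) := rfl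
  have hN (ε : ℝ) := smoothN_eq_unitVec s (u + κ * ε)
  have hB (ε : ℝ) := smoothB_eq_cross s (u + κ * ε)
  simp only [Function.comp_def] at hz hy
  generalize deriv s u = z₀ at *
  generalize deriv (deriv s) u = y₀ at *
  have hz₀ : z₀ ≠ 0 := by rintro rfl; simp [cross] at hu
  have hW₀ : cross (cross z₀ y₀) z₀ ≠ 0 := by
    rw [← norm_ne_zero_iff, norm_cross_cross_self]
    exact mul_ne_zero (norm_ne_zero_iff.2 hu) (norm_ne_zero_iff.2 hz₀)
  have hsq₀ : ‖z₀‖ ^ 2 ≠ 0 := pow_ne_zero _ (norm_ne_zero_iff.2 hz₀)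
  -- The tangent.
  have hG : Tendsto (fun ε => (k * (‖deriv s (u + κ * ε)‖ ^ 2)⁻¹) • deriv s (u + κ * ε))
      (𝓝[≠] 0) (𝓝 ((k * (‖z₀‖ ^ 2)⁻¹) • z₀)) :=
    (((hz.norm.pow 2).inv₀ hsq₀).const_mul k).smul hz
  have hG₀ : (k * (‖z₀‖ ^ 2)⁻¹) • z₀ ≠ 0 := smul_ne_zero (mul_ne_zero hk.ne' (inv_ne_zero hsq₀)) hz₀
  have hεΓ := tendsto_of_isBigO_sub tendsto_sq_punctured hΓ hG
  have hpos : ∀ᶠ ε in 𝓝[≠] 0, deriv s (u + κ * ε) ≠ 0 ∧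
      0 < k * (‖deriv s (u + κ * ε)‖ ^ 2)⁻¹ := by
    filter_upwards [hz.eventually_ne hz₀] with ε hε
    have := norm_pos_iff.2 hε
    exact ⟨hε, by positivity⟩
  have resT : (fun ε => Real.sign ε • unitVec (Γ ε) - smoothT s (u + κ * ε))
      =O[𝓝[≠] 0] (fun ε : ℝ => ε ^ 2) := by
    refine (isBigO_comp_sub (contDiffAt_unitVec hG₀) hεΓ hG hΓ).congr' ?_ .rfl
    filter_upwards [hpos] with ε ⟨_, hε⟩
    rw [unitVec_smul_sign, unitVec_smul hε, hT]
  -- The normal.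
  have hV : Tendsto (fun ε => -ofQuat ((toQuat (deriv s (u + κ * ε)))⁻¹
        * toQuat ((1 / 2 : ℝ) • deriv (deriv s) (u + κ * ε)) * (toQuat (deriv s (u + κ * ε)))⁻¹))
      (𝓝[≠] 0) (𝓝 (-ofQuat ((toQuat z₀)⁻¹ * toQuat ((1 / 2 : ℝ) • y₀) * (toQuat z₀)⁻¹))) := by
    simp only [ofQuat_conj]
    have hy' := hy.const_smul (1 / 2 : ℝ)
    exact ((((hz.norm.pow 2).inv₀ hsq₀).pow 2).smul (((hz.norm.pow 2).smul hy').sub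
      (((hz.inner hy').const_mul 2).smul hz))).neg
  have hO' : (fun ε => O ε - -ofQuat ((toQuat (deriv s (u + κ * ε)))⁻¹
        * toQuat ((1 / 2 : ℝ) • deriv (deriv s) (u + κ * ε)) * (toQuat (deriv s (u + κ * ε)))⁻¹))
      =O[𝓝[≠] 0] fun ε : ℝ => ε ^ 2 := by
    simpa only [sub_neg_eq_add] using hO
  have hOlim := tendsto_of_isBigO_sub tendsto_sq_punctured hO' hV
  have hperp (z y : E3) (hz : z ≠ 0) (k : ℝ) (hk : k ≠ 0) :
      perp (-ofQuat ((toQuat z)⁻¹ * toQuat ((1 / 2 : ℝ) • y) * (toQuat z)⁻¹)) (k • z)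
        = -(((‖z‖ ^ 2)⁻¹ ^ 2 * (1 / 2)) • cross (cross z y) z) := by
    rw [perp_smul_right _ _ hk, perp_neg_left, perp_ofQuat_conj hz, cross_smul_right,
      cross_smul_left, smul_smul]
  have hn := isBigO_comp_sub (contDiffAt_perp hG₀) (hOlim.prodMk_nhds hεΓ) (hV.prodMk_nhds hG)
    (hO'.prod_left hΓ)
  have hnlim := ((contDiffAt_perp hG₀).continuousAt.tendsto.comp (hOlim.prodMk_nhds hεΓ)).neg
  have hglim := ((contDiffAt_perp hG₀).continuousAt.tendsto.comp (hV.prodMk_nhds hG)).neg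
  simp only [Function.comp_def] at hnlim hglim
  have hlim₀ : -perp (-ofQuat ((toQuat z₀)⁻¹ * toQuat ((1 / 2 : ℝ) • y₀) * (toQuat z₀)⁻¹))
      ((k * (‖z₀‖ ^ 2)⁻¹) • z₀) ≠ 0 := by
    rw [hperp _ _ hz₀ _ (mul_ne_zero hk.ne' (inv_ne_zero hsq₀)), neg_neg]
    exact smul_ne_zero (mul_ne_zero (pow_ne_zero _ (inv_ne_zero hsq₀)) (by norm_num)) hW₀
  have resN : (fun ε => -unitVec (perp (O ε) (Γ ε)) - smoothN s (u + κ * ε))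
      =O[𝓝[≠] 0] (fun ε : ℝ => ε ^ 2) := by
    refine (isBigO_comp_sub (contDiffAt_unitVec hlim₀) hnlim hglim
      (hn.neg_left.congr_left fun ε => by abel)).congr' ?_ .rfl
    filter_upwards [self_mem_nhdsWithin, hpos] with ε hε ⟨hzε, hkε⟩
    have := norm_pos_iff.2 hzε
    rw [hperp _ _ hzε _ hkε.ne', neg_neg, unitVec_smul (by positivity), perp_smul_right _ _ hε,
      unitVec_neg, hN]
  -- The binormal.
  have hTlim : Tendsto (fun ε => smoothT s (u + κ * ε)) (𝓝[≠] 0) (𝓝 (unitVec z₀)) :=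
    tendsto_unitVec hz₀ hz
  have hNlim : Tendsto (fun ε => smoothN s (u + κ * ε)) (𝓝[≠] 0)
      (𝓝 (unitVec (cross (cross z₀ y₀) z₀))) := by
    simp only [hN]
    exact tendsto_unitVec hW₀ (tendsto_cross (tendsto_cross hz hy) hz)
  refine ⟨resT, resN, ?_, ?_⟩
  · refine (isBigO_comp_sub (Φ := fun q : E3 × E3 => cross q.1 q.2)
      (x₀ := (unitVec z₀, unitVec (cross (cross z₀ y₀) z₀)))
      (f := fun ε => (Real.sign ε • unitVec (Γ ε), -unitVec (perp (O ε) (Γ ε))))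
      (g := fun ε => (smoothT s (u + κ * ε), smoothN s (u + κ * ε))) contDiff_cross.contDiffAt
      ((tendsto_of_isBigO_sub tendsto_sq_punctured resT hTlim).prodMk_nhds
        (tendsto_of_isBigO_sub tendsto_sq_punctured resN hNlim))
      (hTlim.prodMk_nhds hNlim) (resT.prod_left resN)).congr' ?_ .rfl
    filter_upwards [hpos] with ε ⟨hzε, _⟩
    rw [cross_smul_left, hB ε hzε]
  · filter_upwards [self_mem_nhdsWithin, hnlim.eventually_ne hlim₀] with ε hε h0
    rw [perp_smul_right _ _ hε, neg_ne_zero] at h0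
    exact h0

/-! ### The discrete Frenet frame in the inverted picture -/

/-- The discrete Frenet frame in terms of the picture inverted at the inserted point `p` of the
edge: with `b, c` at `o ± v` and `a, d` at `o ± w`, the curvature circle is mapped to the line
through `o` in the direction of the geometric mean `√(w v⁻¹) v` of `v` and `w`. -/
theorem isDiscreteFrenetFrame_iff_of_inverted {γ : ℤ → E3} {i : ℤ} {p o v w : ℍ[ℝ]} {O Γ : E3}
    (hd : γ (i - 1) ≠ γ i ∧ γ (i - 1) ≠ γ (i + 1) ∧ γ (i - 1) ≠ γ (i + 2) ∧ γ i ≠ γ (i + 1) ∧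
      γ i ≠ γ (i + 2) ∧ γ (i + 1) ≠ γ (i + 2))
    (hneg : ¬ ((crossRatio (toQuat (γ (i + 1))) (toQuat (γ (i - 1))) (toQuat (γ i))
      (toQuat (γ (i + 2)))).im = 0 ∧ (crossRatio (toQuat (γ (i + 1))) (toQuat (γ (i - 1)))
      (toQuat (γ i)) (toQuat (γ (i + 2)))).re < 0))
    (h1 : insertFactor (toQuat (γ (i - 1))) (toQuat (γ i)) (toQuat (γ (i + 1)))
      (toQuat (γ (i + 2))) + 1 ≠ 0)
    (hp : p = insertPoint (toQuat (γ (i - 1))) (toQuat (γ i)) (toQuat (γ (i + 1)))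
      (toQuat (γ (i + 2))))
    (ho : o = (2 : ℝ)⁻¹ • ((toQuat (γ i) - p)⁻¹ + (toQuat (γ (i + 1)) - p)⁻¹))
    (hv : v = (2 : ℝ)⁻¹ • ((toQuat (γ i) - p)⁻¹ - (toQuat (γ (i + 1)) - p)⁻¹))
    (hw : w = (2 : ℝ)⁻¹ • ((toQuat (γ (i - 1)) - p)⁻¹ - (toQuat (γ (i + 2)) - p)⁻¹))
    (hwv : 0 < (w * v⁻¹).re) (hlt : ‖w‖ < ‖v‖)
    (hO : O = ofQuat o) (hΓ : Γ = ofQuat (quatSqrt (w * v⁻¹) * v))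
    (hn : perp O Γ ≠ 0) (he : 0 < inner ℝ Γ (γ (i + 1) - γ i)) (G : Frame3) :
    IsDiscreteFrenetFrame γ i G ↔
      G = ⟨unitVec Γ, -unitVec (perp O Γ), cross (unitVec Γ) (-unitVec (perp O Γ))⟩ := by
  obtain ⟨hab, hac, had, hbc, hbd, hcd⟩ := hd
  have hv0 : v ≠ 0 := norm_pos_iff.1 ((norm_nonneg w).trans_lt hlt)
  have hw0 : w ≠ 0 := by rintro rfl; simp at hwv
  have hnn : ¬ ((w * v⁻¹).im = 0 ∧ (w * v⁻¹).re < 0) := fun h => absurd h.2 (not_lt.2 hwv.le)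
  have hσ := quatSqrt_re_pos (mul_ne_zero hw0 (inv_ne_zero hv0)) hnn
  have hσσ := quatSqrt_mul_self hnn
  have hσs := quatSqrt_mem_span (w * v⁻¹)
  generalize quatSqrt (w * v⁻¹) = σ at *
  have hpre : p.re = 0 := hp ▸ insertPoint_re rfl rfl rfl rfl (toQuat_injective.ne hab)
    (toQuat_injective.ne hac) (toQuat_injective.ne hcd)
  obtain ⟨⟨ha0, hb0, hc0, hd0⟩, hpar⟩ := parallelogram_of_insertFactor (toQuat_injective.ne hab)
    (toQuat_injective.ne hac) (toQuat_injective.ne hbc) (toQuat_injective.ne hbd)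
    (toQuat_injective.ne hcd) hneg ((insertPoint_eq_iff h1).1 hp)
  have hpp : toQuat (ofQuat p) = p := toQuat_ofQuat hpre
  have hre (z : E3) : ((toQuat z - p)⁻¹).re = 0 := inv_re_eq_zero (by simp [hpre])
  have hore : o.re = 0 := by rw [ho]; simp [hre]
  have hvre : v.re = 0 := by rw [hv]; simp [hre]
  have hwre : w.re = 0 := by rw [hw]; simp [hre]
  have hgre : (σ * v).re = 0 := by
    obtain ⟨α, β, h⟩ := hσs
    rw [h, add_mul, smul_mul_assoc, smul_mul_assoc, one_mul, inv_mul_cancel_right₀ hv0]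
    simp [hvre, hwre]
  have hOo : toQuat O = o := by rw [hO, toQuat_ofQuat hore]
  have hΓg : toQuat Γ = σ * v := by rw [hΓ, toQuat_ofQuat hgre]
  have hΓ0 : Γ ≠ 0 := by rintro rfl; simp at he
  have hng := inner_perp O hΓ0
  obtain ⟨t, ht⟩ : ∃ t, t = inner ℝ O Γ / ‖Γ‖ ^ 2 := ⟨_, rfl⟩
  have hdec (τ : ℝ) : perp O Γ + (t + τ) • Γ = O + τ • Γ := by rw [perp, ← ht]; module
  have hline (τ : ℝ) : toQuat (perp O Γ + (t + τ) • Γ) = o + τ • (σ * v) := by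
    rw [hdec, toQuat_add, toQuat_smul, hOo, hΓg]
  have hne (τ : ℝ) : o + τ • (σ * v) ≠ 0 := by
    rw [← hline, Ne, toQuat_eq_zero_iff]
    exact add_smul_ne_zero hng hn _
  have hpt (τ : ℝ) : toQuat (ofQuat p + negInv (perp O Γ + (t + τ) • Γ))
      = toQuat (ofQuat p) + (o + τ • (σ * v))⁻¹ := by
    rw [toQuat_add, toQuat_negInv, hline]
  have hA : o + w = (toQuat (γ (i - 1)) - p)⁻¹ := by rw [ho, hw, ← hpar]; module
  have hB : o + v = (toQuat (γ i) - p)⁻¹ := by rw [ho, hv]; module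
  have hC : o + -v = (toQuat (γ (i + 1)) - p)⁻¹ := by rw [ho, hv]; module
  have hD : o + -w = (toQuat (γ (i + 2)) - p)⁻¹ := by rw [ho, hw, ← hpar]; module
  obtain ⟨k1, k2, k3⟩ := isInsertedPoint_of_parallelogram (p := ofQuat p)
    (pab := ofQuat p + negInv (perp O Γ + (t + 1) • Γ))
    (pcd := ofQuat p + negInv (perp O Γ + (t - 1) • Γ))
    (pda := ofQuat p + negInv (perp O Γ + t • Γ)) (o := o) (v := v) (w := w) (σ := σ)
    hab hac had hbc hbd hcd (hA ▸ inv_ne_zero ha0) (hB ▸ inv_ne_zero hb0) (hC ▸ inv_ne_zero hc0)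
    (hD ▸ inv_ne_zero hd0) (by simpa using hne 0) (by simpa using hne 1) (by simpa using hne (-1))
    (by rw [hA, inv_inv, hpp]; abel) (by rw [hB, inv_inv, hpp]; abel)
    (by rw [hC, inv_inv, hpp]; abel) (by rw [hD, inv_inv, hpp]; abel)
    (by simpa using hpt 1) (by simpa [sub_eq_add_neg] using hpt (-1)) (by simpa using hpt 0)
    hσ hσσ hlt
  exact isDiscreteFrenetFrame_iff hng hn he k1
    ⟨⟨hab, hac, had, hbc, hbd, hcd⟩, hneg, h1, hpp.trans hp⟩ k2 k3 G

/-! ### Sampled curves -/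

theorem isBigO_toQuat_iff {l : Filter ℝ} {f : ℝ → E3} {φ : ℝ → ℝ} :
    (fun ε => toQuat (f ε)) =O[l] φ ↔ f =O[l] φ := by
  rw [← isBigO_norm_left, ← isBigO_norm_left (f' := f)]
  simp only [norm_toQuat]

theorem norm_ofQuat_le (q : ℍ[ℝ]) : ‖ofQuat q‖ ≤ ‖q‖ := by
  rw [← sq_le_sq₀ (norm_nonneg _) (norm_nonneg _), norm_sq_eq_components,
    EuclideanSpace.norm_sq_eq, Fin.sum_univ_three]
  simp only [ofQuat, Real.norm_eq_abs, sq_abs]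
  have := sq_nonneg q.re
  simp
  linarith

theorem isBigO_ofQuat {l : Filter ℝ} {f : ℝ → ℍ[ℝ]} {φ : ℝ → ℝ} (h : f =O[l] φ) :
    (fun ε => ofQuat (f ε)) =O[l] φ :=
  (IsBigO.of_bound 1 (.of_forall fun ε => by simpa using norm_ofQuat_le (f ε))).trans h

theorem tendsto_toQuat {l : Filter ℝ} {f : ℝ → E3} {a : E3} (hf : Tendsto f l (𝓝 a)) :
    Tendsto (fun ε => toQuat (f ε)) l (𝓝 (toQuat a)) := by
  rw [tendsto_iff_norm_sub_tendsto_zero] at hf ⊢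
  simpa only [← toQuat_sub, norm_toQuat] using hf

/-- The expansion of four consecutive sampled points about the point at the parameter `u + κ ε`. -/
theorem edgeExpansion_curve {s : ℝ → E3} (hs : ContDiff ℝ 4 s) {u : ℝ} (hu : deriv s u ≠ 0)
    (κ : ℝ) :
    EdgeExpansion (fun ε => toQuat (s (u + (κ - 3) * ε))) (fun ε => toQuat (s (u + (κ - 1) * ε)))
      (fun ε => toQuat (s (u + (κ + 1) * ε))) (fun ε => toQuat (s (u + (κ + 3) * ε)))
      (fun ε => toQuat (s (u + κ * ε))) (fun ε => toQuat (symmSub s u κ 1 ε))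
      (fun ε => toQuat (symmAdd s u κ 1 ε)) (fun ε => toQuat (symmSub s u κ 3 ε))
      (fun ε => toQuat (symmAdd s u κ 3 ε)) (toQuat (deriv s u))
      (toQuat ((1 / 2 : ℝ) • deriv (deriv s) u)) := by
  have hs' : ContDiff ℝ 3 (deriv s) := contDiff_deriv_of_succ (n := 3) (by exact_mod_cast hs)
  have hs'' : ContDiff ℝ 2 (deriv (deriv s)) :=
    contDiff_deriv_of_succ (n := 2) (by exact_mod_cast hs')
  have hz := (hs'.continuous.tendsto u).comp (tendsto_add_mul u κ)
  have hy := ((hs''.continuous.tendsto u).comp (tendsto_add_mul u κ)).const_smul (1 / 2 : ℝ)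
  have x1 := isBigO_symmSub hs u κ 1
  have x3 := isBigO_symmSub hs u κ 3
  have y1 := isBigO_symmAdd hs u κ 1
  have y3 := isBigO_symmAdd hs u κ 3
  constructor
  · intro ε hε
    rw [sub_eq_symm s u κ 3 hε]
    simp only [toQuat_add, toQuat_smul, toQuat_neg]
  · intro ε hε
    rw [sub_eq_symm s u κ 1 hε]
    simp only [toQuat_add, toQuat_smul, toQuat_neg]
  · intro ε hε
    rw [add_eq_symm s u κ 1 hε]
    simp only [toQuat_add, toQuat_smul]
  · intro ε hε
    rw [add_eq_symm s u κ 3 hε]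
    simp only [toQuat_add, toQuat_smul]
  · rwa [Ne, toQuat_eq_zero_iff]
  · exact tendsto_toQuat (tendsto_of_isBigO_sub tendsto_sq_punctured
      (x1.congr_left fun ε => by rw [one_smul]; rfl) hz)
  · exact tendsto_toQuat (tendsto_of_isBigO_sub tendsto_sq_punctured
      (y1.congr_left fun ε => by norm_num) hy)
  · simp only [← toQuat_smul, ← toQuat_sub]
    rw [isBigO_toQuat_iff]
    refine (x3.sub (x1.const_smul_left (3 : ℝ))).congr_left fun ε => ?_
    simp only [Pi.smul_apply]
    module
  · simp only [← toQuat_smul, ← toQuat_sub]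
    rw [isBigO_toQuat_iff]
    refine (y3.sub (y1.const_smul_left (9 : ℝ))).congr_left fun ε => ?_
    simp only [Pi.smul_apply]
    module

/-! ### The asymptotics of the discrete Frenet frame -/

theorem ofQuat_add (p q : ℍ[ℝ]) : ofQuat (p + q) = ofQuat p + ofQuat q := by
  ext i; fin_cases i <;> simp [ofQuat]

theorem ofQuat_smul (t : ℝ) (q : ℍ[ℝ]) : ofQuat (t • q) = t • ofQuat q := by
  ext i; fin_cases i <;> simp [ofQuat]

/-- The geometric mean of `v` and `w` in the picture inverted at the inserted point. The quotient
`w v⁻¹` tends to `1 / 3`, the inverse ratio of the distances of `c` and `d` from `p`. -/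
theorem EdgeExpansion.geometricMean_isBigO {a b c d m x y x₃ y₃ : ℝ → ℍ[ℝ]} {x₀ y₀ : ℍ[ℝ]}
    (h : EdgeExpansion a b c d m x y x₃ y₃ x₀ y₀) {v w : ℝ → ℍ[ℝ]}
    (hv : (fun ε => ε • v ε + (x ε)⁻¹) =O[𝓝[≠] 0] (fun ε : ℝ => ε ^ 2))
    (hw : (fun ε => ε • w ε + (3 : ℝ)⁻¹ • (x ε)⁻¹) =O[𝓝[≠] 0] (fun ε : ℝ => ε ^ 2)) :
    (fun ε => ε • (quatSqrt (w ε * (v ε)⁻¹) * v ε) + (Real.sqrt 3)⁻¹ • (x ε)⁻¹)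
        =O[𝓝[≠] 0] (fun ε : ℝ => ε ^ 2) ∧
      (∀ᶠ ε in 𝓝[≠] 0, 0 < (w ε * (v ε)⁻¹).re) ∧ ∀ᶠ ε in 𝓝[≠] 0, ‖w ε‖ < ‖v ε‖ := by
  have hxi := h.tendsto_x.inv₀ h.x_ne
  have hx0 : -x₀⁻¹ ≠ 0 := neg_ne_zero.2 (inv_ne_zero h.x_ne)
  have hv' : (fun ε => ε • v ε - -(x ε)⁻¹) =O[𝓝[≠] 0] (fun ε : ℝ => ε ^ 2) := by
    simpa only [sub_neg_eq_add] using hv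
  have hw' : (fun ε => ε • w ε - -((3 : ℝ)⁻¹ • (x ε)⁻¹)) =O[𝓝[≠] 0] (fun ε : ℝ => ε ^ 2) := by
    simpa only [sub_neg_eq_add] using hw
  have tv := tendsto_of_isBigO_sub tendsto_sq_punctured hv' hxi.neg
  have tw := tendsto_of_isBigO_sub tendsto_sq_punctured hw' (hxi.const_smul _).neg
  have hvi := isBigO_inv_sub_inv hx0 hv' tv hxi.neg
  have hq : (fun ε => w ε * (v ε)⁻¹ - ((Real.sqrt 3)⁻¹ ^ 2) • (1 : ℍ[ℝ])) =O[𝓝[≠] 0]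
      (fun ε : ℝ => ε ^ 2) := by
    refine (isBigO_mul_sub_mul hw' hvi (tw.isBigO_one ℝ)
      ((hxi.neg.inv₀ hx0).isBigO_one ℝ)).congr' ?_ .rfl
    filter_upwards [self_mem_nhdsWithin, h.tendsto_x.eventually_ne h.x_ne] with ε hε hxε
    have h3 : (Real.sqrt 3)⁻¹ ^ 2 = (3 : ℝ)⁻¹ := by rw [inv_pow, Real.sq_sqrt (by norm_num)]
    rw [h3, smul_inv₀, smul_mul_smul_comm, mul_inv_cancel₀ hε, one_smul, inv_neg, inv_inv,
      neg_mul_neg, smul_mul_assoc, inv_mul_cancel₀ hxε]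
  have hk : 0 < (Real.sqrt 3)⁻¹ := by positivity
  have hσ := isBigO_quatSqrt_sub hk tendsto_sq_punctured hq
  have tσ := tendsto_of_isBigO_sub tendsto_sq_punctured hσ tendsto_const_nhds
  refine ⟨?_, ?_, ?_⟩
  · refine (isBigO_mul_sub_mul hσ hv' (tσ.isBigO_one ℝ) (hxi.neg.isBigO_one ℝ)).congr_left
      fun ε => ?_
    rw [mul_smul_comm, smul_mul_assoc, one_mul, smul_neg, sub_neg_eq_add]
  · have tq := tendsto_of_isBigO_sub tendsto_sq_punctured hq tendsto_const_nhds
    have := (Quaternion.continuous_re.tendsto _).comp tq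
    refine this.eventually (lt_mem_nhds ?_)
    simp
  · have hlim : ‖-((3 : ℝ)⁻¹ • x₀⁻¹)‖ < ‖-x₀⁻¹‖ := by
      have : 0 < ‖x₀⁻¹‖ := norm_pos_iff.2 (inv_ne_zero h.x_ne)
      rw [norm_neg, norm_neg, norm_smul, Real.norm_of_nonneg (by norm_num)]
      linarith
    filter_upwards [self_mem_nhdsWithin, tw.norm.eventually_lt tv.norm hlim] with ε hε hlt
    rw [norm_smul, norm_smul] at hlt
    exact lt_of_mul_lt_mul_left hlt (norm_nonneg _)

/-- For a `C⁴` space curve with `s' × s'' ≠ 0` at `u`, the discrete Frenet frame of the sampled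
polygon at the edge `γ_i γ_{i+1}` exists, is unique, and is a second order approximation of the
smooth Frenet frame at the mid-parameter `u + 2 i ε` of the edge (which is `u` for `i = 0`). For
`ε < 0` the polygon runs against `s`, so that the tangent and the binormal change their sign. -/
theorem mainTheorem6 (s : ℝ → E3) (hs : ContDiff ℝ 4 s) (u : ℝ)
    (hu : cross (deriv s u) (deriv (deriv s) u) ≠ 0) (i : ℤ) :
    ∃ F : ℝ → Frame3,
      (∀ᶠ ε in 𝓝[≠] (0 : ℝ), ∀ G : Frame3,
        IsDiscreteFrenetFrame (sample s u ε) i G ↔ G = F ε) ∧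
      (fun ε : ℝ => Real.sign ε • (F ε).T - smoothT s (u + 2 * i * ε))
        =O[𝓝[≠] 0] (fun ε : ℝ => ε ^ 2) ∧
      (fun ε : ℝ => (F ε).N - smoothN s (u + 2 * i * ε))
        =O[𝓝[≠] 0] (fun ε : ℝ => ε ^ 2) ∧
      (fun ε : ℝ => Real.sign ε • (F ε).B - smoothB s (u + 2 * i * ε))
        =O[𝓝[≠] 0] (fun ε : ℝ => ε ^ 2) := by
  have hz₀ : deriv s u ≠ 0 := by intro h; rw [h] at hu; simp [cross] at hu
  obtain ⟨κ, hκ⟩ : ∃ κ : ℝ, κ = 2 * i := ⟨_, rfl⟩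
  rw [← hκ]
  have h := edgeExpansion_curve hs hz₀ κ
  obtain ⟨p, hp⟩ : ∃ p : ℝ → ℍ[ℝ], ∀ ε, p ε = insertPoint (toQuat (s (u + (κ - 3) * ε)))
    (toQuat (s (u + (κ - 1) * ε))) (toQuat (s (u + (κ + 1) * ε)))
    (toQuat (s (u + (κ + 3) * ε))) := ⟨_, fun _ => rfl⟩
  obtain ⟨o, ho⟩ : ∃ o : ℝ → ℍ[ℝ], ∀ ε, o ε = (2 : ℝ)⁻¹ •
    ((toQuat (s (u + (κ - 1) * ε)) - p ε)⁻¹ + (toQuat (s (u + (κ + 1) * ε)) - p ε)⁻¹) :=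
    ⟨_, fun _ => rfl⟩
  obtain ⟨v, hv⟩ : ∃ v : ℝ → ℍ[ℝ], ∀ ε, v ε = (2 : ℝ)⁻¹ •
    ((toQuat (s (u + (κ - 1) * ε)) - p ε)⁻¹ - (toQuat (s (u + (κ + 1) * ε)) - p ε)⁻¹) :=
    ⟨_, fun _ => rfl⟩
  obtain ⟨w, hw⟩ : ∃ w : ℝ → ℍ[ℝ], ∀ ε, w ε = (2 : ℝ)⁻¹ •
    ((toQuat (s (u + (κ - 3) * ε)) - p ε)⁻¹ - (toQuat (s (u + (κ + 3) * ε)) - p ε)⁻¹) :=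
    ⟨_, fun _ => rfl⟩
  obtain ⟨bo, bv, bw⟩ := h.inverted_isBigO hp ho hv hw
  obtain ⟨bg, hre, hlt⟩ := h.geometricMean_isBigO bv bw
  obtain ⟨O, hO⟩ : ∃ O : ℝ → E3, ∀ ε, O ε = ofQuat (o ε) := ⟨_, fun _ => rfl⟩
  obtain ⟨Γ, hΓ⟩ : ∃ Γ : ℝ → E3, ∀ ε, Γ ε = ofQuat (quatSqrt (w ε * (v ε)⁻¹) * v ε) :=
    ⟨_, fun _ => rfl⟩
  have hk : 0 < (Real.sqrt 3)⁻¹ := by positivity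
  -- Replace the difference quotients by the derivatives at `u + κ ε`.
  have hs' : ContDiff ℝ 3 (deriv s) := contDiff_deriv_of_succ (n := 3) (by exact_mod_cast hs)
  have hs'' : ContDiff ℝ 2 (deriv (deriv s)) :=
    contDiff_deriv_of_succ (n := 2) (by exact_mod_cast hs')
  have tz : Tendsto (fun ε => deriv s (u + κ * ε)) (𝓝[≠] 0) (𝓝 (deriv s u)) :=
    (hs'.continuous.tendsto u).comp (tendsto_add_mul u κ)
  have tzq := tendsto_toQuat tz
  have ty : Tendsto (fun ε => (1 / 2 : ℝ) • deriv (deriv s) (u + κ * ε)) (𝓝[≠] 0)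
      (𝓝 ((1 / 2 : ℝ) • deriv (deriv s) u)) :=
    ((hs''.continuous.tendsto u).comp (tendsto_add_mul u κ)).const_smul _
  have hxz : (fun ε => toQuat (symmSub s u κ 1 ε) - toQuat (deriv s (u + κ * ε)))
      =O[𝓝[≠] 0] fun ε : ℝ => ε ^ 2 := by
    simp only [← toQuat_sub]
    rw [isBigO_toQuat_iff]
    simpa only [one_smul] using isBigO_symmSub hs u κ 1
  have hyz : (fun ε => toQuat (symmAdd s u κ 1 ε)
      - toQuat ((1 / 2 : ℝ) • deriv (deriv s) (u + κ * ε))) =O[𝓝[≠] 0] fun ε : ℝ => ε ^ 2 := by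
    simp only [← toQuat_sub]
    rw [isBigO_toQuat_iff]
    simpa only [one_pow] using isBigO_symmAdd hs u κ 1
  have hxi := isBigO_inv_sub_inv h.x_ne hxz h.tendsto_x tzq
  have hxiO := (h.tendsto_x.inv₀ h.x_ne).isBigO_one ℝ
  have hziO := (tzq.inv₀ h.x_ne).isBigO_one ℝ
  have hΓO : (fun ε => ε • Γ ε - ((Real.sqrt 3)⁻¹ * (‖deriv s (u + κ * ε)‖ ^ 2)⁻¹)
      • deriv s (u + κ * ε)) =O[𝓝[≠] 0] fun ε : ℝ => ε ^ 2 := by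
    refine (isBigO_ofQuat (bg.sub (hxi.const_smul_left (Real.sqrt 3)⁻¹))).congr_left fun ε => ?_
    have e : ε • (quatSqrt (w ε * (v ε)⁻¹) * v ε) + (Real.sqrt 3)⁻¹ • (toQuat (symmSub s u κ 1 ε))⁻¹
        - (Real.sqrt 3)⁻¹ • ((toQuat (symmSub s u κ 1 ε))⁻¹ - (toQuat (deriv s (u + κ * ε)))⁻¹)
        = ε • (quatSqrt (w ε * (v ε)⁻¹) * v ε)
          + (Real.sqrt 3)⁻¹ • toQuat (negInv (deriv s (u + κ * ε))) := by
      rw [toQuat_negInv]; module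
    simp only [Pi.smul_apply]
    rw [e, ofQuat_add, ofQuat_smul, ofQuat_smul, ofQuat_toQuat, ← hΓ, negInv]
    module
  have hOO : (fun ε => O ε + ofQuat ((toQuat (deriv s (u + κ * ε)))⁻¹
      * toQuat ((1 / 2 : ℝ) • deriv (deriv s) (u + κ * ε)) * (toQuat (deriv s (u + κ * ε)))⁻¹))
      =O[𝓝[≠] 0] fun ε : ℝ => ε ^ 2 := by
    have hyO := (tendsto_toQuat ty).isBigO_one ℝ
    have e1 := isBigO_mul_sub_mul (isBigO_mul_sub_mul hxi hyz hxiO hyO) hxi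
      (by simpa using hxiO.mul (h.tendsto_y.isBigO_one ℝ)) hziO
    refine (isBigO_ofQuat (bo.sub e1)).congr_left fun ε => ?_
    rw [hO, ← ofQuat_add]
    congr 1
    abel
  obtain ⟨rT, rN, rB, hn⟩ := frame_isBigO hs hu hk hΓO hOO
  refine ⟨fun ε => ⟨unitVec (Γ ε), -unitVec (perp (O ε) (Γ ε)),
    cross (unitVec (Γ ε)) (-unitVec (perp (O ε) (Γ ε)))⟩, ?_, rT, rN, rB⟩
  -- The orientation of the edge.
  have he : ∀ᶠ ε in 𝓝[≠] 0, 0 < inner ℝ (Γ ε) (s (u + (κ + 1) * ε) - s (u + (κ - 1) * ε)) := by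
    have hn0 : 0 < ‖deriv s u‖ := norm_pos_iff.2 hz₀
    have tΓ := tendsto_of_isBigO_sub tendsto_sq_punctured hΓO
      ((((tz.norm.pow 2).inv₀ (by positivity)).const_mul _).smul tz)
    have tx : Tendsto (fun ε => symmSub s u κ 1 ε) (𝓝[≠] 0) (𝓝 (deriv s u)) := by
      refine tendsto_of_isBigO_sub tendsto_sq_punctured ?_ tz
      simpa only [one_smul] using isBigO_symmSub hs u κ 1
    have hpos : 0 < inner ℝ (((Real.sqrt 3)⁻¹ * (‖deriv s u‖ ^ 2)⁻¹) • deriv s u) (deriv s u) := by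
      rw [real_inner_smul_left, real_inner_self_eq_norm_sq]
      positivity
    filter_upwards [self_mem_nhdsWithin, (tΓ.inner tx).eventually (lt_mem_nhds hpos)] with ε hε hi
    have hε' : ε ≠ 0 := hε
    rw [symmSub, real_inner_smul_left, real_inner_smul_right] at hi
    have : ε * ((2 * ε)⁻¹ * inner ℝ (Γ ε) (s (u + (κ + 1) * ε) - s (u + (κ - 1) * ε)))
        = 2⁻¹ * inner ℝ (Γ ε) (s (u + (κ + 1) * ε) - s (u + (κ - 1) * ε)) := by field_simp
    rw [this] at hi
    linarith
  filter_upwards [h.eventually_distinct, h.eventually_not_neg,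
    h.eventually_insertFactor_add_one_ne, hre, hlt, hn, he] with ε hd hneg h1 hre hlt hn he G
  have eA : sample s u ε (i - 1) = s (u + (κ - 3) * ε) := by
    rw [sample, hκ]; congr 1; push_cast; ring
  have eB : sample s u ε i = s (u + (κ - 1) * ε) := by rw [sample, hκ]
  have eC : sample s u ε (i + 1) = s (u + (κ + 1) * ε) := by
    rw [sample, hκ]; congr 1; push_cast; ring
  have eD : sample s u ε (i + 2) = s (u + (κ + 3) * ε) := by
    rw [sample, hκ]; congr 1; push_cast; ring
  simp only [ne_eq, toQuat_injective.eq_iff] at hd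
  refine isDiscreteFrenetFrame_iff_of_inverted (p := p ε) (o := o ε) (v := v ε) (w := w ε)
    ?_ ?_ ?_ ?_ ?_ ?_ ?_ hre hlt (hO ε) (hΓ ε) hn ?_ G <;> simp only [eA, eB, eC, eD]
  exacts [hd, hneg, h1, hp ε, ho ε, hv ε, hw ε, he]
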